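/- Let $R$ be an ordered (commutative, unital) ring and $C = R(i)$ with $i^2=-1$. All algebras are unital associative $C$-algebras, all modules are unital and all bimodules are $C$-central (both actions induce the same $C$-module structure); a $*$-algebra is a $C$-algebra with an antilinear involutive anti-automorphism. An element $a$ of a $*$-algebra $\mathcal A$ is *positive* ($a\in\mathcal A^+$) if $\omega(a)\ge 0$ for every $C$-linear $\omega:\mathcal A\to C$ with $\omega(b^*b)\ge 0$ for all $b$; a projection is an element $P=P^2=P^*$. Consider the following conditions. * **(I)** For all $n$ and $M\in M_n(\mathcal A)$, $1+M^*M$ is invertible. * **(II)** For all $n$, pairwise orthogonal projections $P_1,\dots,P_m\in M_n(\mathcal A)$ with $\sum_\alpha P_\alpha=1$ and invertible $H\in M_n(\mathcal A)^+$ with $[H,P_\alpha]=0$ for all $\alpha$, there is an invertible $U\in M_n(\mathcal A)$ with $H=U^*U$ and $[P_\alpha,U]=0$ for all $\alpha$. * **(II$^-$)** For all $n$, invertible $H\in M_n(\mathcal A)^+$ and projections $P\in M_n(\mathcal A)$ with $[P,H]=0$, there is $U\in M_n(\mathcal A)$ with $H=U^*U$ and $[P,U]=0$. * **(III)** (for a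 pair $\mathcal A,\mathcal B$) For all $n$ and projections $P\in M_n(\mathcal A)$: if $\mathcal B$ and $PM_n(\mathcal A)P$ are isomorphic as unital algebras, then they are $*$-isomorphic. A $(\mathcal B,\mathcal A)$-bimodule is *invertible* if it has an inverse, up to isomorphism, with respect to the tensor products over $\mathcal A$ and $\mathcal B$; $\mathrm{Pic}(\mathcal B,\mathcal A)$ is the set of isomorphism classes of invertible $(\mathcal B,\mathcal A)$-bimodules, on which $\mathrm{Aut}(\mathcal B)$ (automorphisms of the unital algebra $\mathcal B$) acts by $[\mathcal E]\mapsto[{}_\Phi\mathcal E]$, with $b\cdot_\Phi x\cdot a=\Phi(b)xa$. The algebras are *ring-theoretically Morita equivalent* if $\mathrm{Pic}(\mathcal B,\mathcal A)\neq\emptyset$. An $\mathcal A$-valued inner product on a right $\mathcal A$-module is a form that is $C$- and $\mathcal A$-linear in the second argument with $\langle x,y\rangle^*=\langle y,x\rangle$ (on a left module, linearity is in the first argument). It is *completely positive* if $(\langle x_i,x_j\rangle)_{ij}\in M_n(\mathcal A)^+$ for all $n$ and $x_1,\dots,x_n$, *non-degenerate* if $\langle x,\cdot\rangle=0$ implies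 $x=0$, and *full* if its values span $\mathcal A$ over $C$. A *pre-Hilbert $(\mathcal B,\mathcal A)$-bimodule* is a bimodule with a non-degenerate, completely positive $\mathcal A$-valued inner product such that $\langle bx,y\rangle=\langle x,b^*y\rangle$. $\mathrm{StrPic}(\mathcal B,\mathcal A)$ is the set of classes, up to bimodule isomorphisms preserving inner products, of pre-Hilbert $(\mathcal B,\mathcal A)$-bimodules that have an inverse pre-Hilbert $(\mathcal A,\mathcal B)$-bimodule for the internal tensor product (the tensor product with $\langle y_1\otimes x_1,y_2\otimes x_2\rangle=\langle x_1,\langle y_1,y_2\rangle x_2\rangle$, modulo its degeneracy space); the units are the algebras with $\langle a,b\rangle=a^*b$. The algebras are *strongly Morita equivalent* if there is a $(\mathcal B,\mathcal A)$-bimodule with an $\mathcal A$-valued and a $\mathcal B$-valued inner product, both non-degenerate, full, completely positive and compatible with the action of the other algebra, such that $x\cdot\langle y,z\rangle_{\mathcal A}={}_{\mathcal B}\langle x,y\rangle\cdot z$. **Statement.** 1. Let $\mathcal A,\mathcal B$ be unital $*$-algebras satisfying (III), and let $\mathcal A$ satisfy (I) and (II$^-$). Then forgetting inner products gives a map $\mathrm{StrPic}(\mathcal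 B,\mathcal A)\to\mathrm{Pic}(\mathcal B,\mathcal A)$ whose composition with $\mathrm{Pic}(\mathcal B,\mathcal A)\to\mathrm{Pic}(\mathcal B,\mathcal A)/\mathrm{Aut}(\mathcal B)$ is onto. 2. Let $\mathcal K$ be a class of unital $*$-algebras each of which satisfies (I) and (II) and every (ordered) pair of which satisfies (III). Then any two members of $\mathcal K$ are ring-theoretically Morita equivalent if and only if they are strongly Morita equivalent; on $\mathcal K$ these relations are one and the same equivalence relation. -/

import Mathlib

open scoped TensorProduct
open MulOpposite (op)

universe u v

/-! ### Bimodules over unital algebras -/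

/-- A `(B, A)`-bimodule over the commutative ring `k`: a left `B`-module and right `A`-module
(a module over the opposite algebra) with commuting actions, both compatible with one and the same
`k`-module structure. Modules are unital. -/
structure AlgBimod (k : Type v) (B A : Type u) [CommRing k] [Ring B] [Algebra k B]
    [Ring A] [Algebra k A] : Type (max v (u + 1)) where
  carrier : Type u
  [addCommGroup : AddCommGroup carrier]
  [scalar : Module k carrier]
  [left : Module B carrier]
  [right : Module Aᵐᵒᵖ carrier]
  [comm : SMulCommClass B Aᵐᵒᵖ carrier]
  [towerLeft : IsScalarTower k B carrier]
  [towerRight : IsScalarTower k Aᵐᵒᵖ carrier]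

attribute [instance] AlgBimod.addCommGroup AlgBimod.scalar AlgBimod.left AlgBimod.right AlgBimod.comm
  AlgBimod.towerLeft AlgBimod.towerRight

namespace AlgBimod

section

variable {k : Type v} {D B A : Type u} [CommRing k] [Ring D] [Algebra k D] [Ring B] [Algebra k B]
  [Ring A] [Algebra k A]

/-- Isomorphism of bimodules. -/
def Iso (E F : AlgBimod k B A) : Prop :=
  ∃ f : E.carrier ≃ₗ[k] F.carrier,
    (∀ (b : B) (x : E.carrier), f (b • x) = b • f x) ∧
    (∀ (a : A) (x : E.carrier), f (op a • x) = op a • f x)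

theorem Iso.refl (E : AlgBimod k B A) : Iso E E :=
  ⟨LinearEquiv.refl k _, fun _ _ => rfl, fun _ _ => rfl⟩

theorem Iso.symm {E F : AlgBimod k B A} : Iso E F → Iso F E := by
  rintro ⟨f, h1, h2⟩
  refine ⟨f.symm, fun b x => ?_, fun a x => ?_⟩
  · rw [LinearEquiv.symm_apply_eq, h1, LinearEquiv.apply_symm_apply]
  · rw [LinearEquiv.symm_apply_eq, h2, LinearEquiv.apply_symm_apply]

theorem Iso.trans {E F G : AlgBimod k B A} : Iso E F → Iso F G → Iso E G := by
  rintro ⟨f, h1, h2⟩ ⟨g, h3, h4⟩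
  exact ⟨f.trans g, fun b x => by simp [h1, h3], fun a x => by simp [h2, h4]⟩

/-- The algebra `A` as an `(A, A)`-bimodule via multiplication. -/
def self (k : Type v) (A : Type u) [CommRing k] [Ring A] [Algebra k A] : AlgBimod k A A where
  carrier := A

/-- Left multiplication as a linear map. -/
def lmul (E : AlgBimod k B A) (b : B) : E.carrier →ₗ[k] E.carrier where
  toFun x := b • x
  map_add' := smul_add b
  map_smul' c x := smul_comm b c x

/-- Right multiplication as a linear map. -/
def rmul (E : AlgBimod k B A) (a : Aᵐᵒᵖ) : E.carrier →ₗ[k] E.carrier where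
  toFun x := a • x
  map_add' := smul_add a
  map_smul' c x := smul_comm a c x

/-- The quotient of a bimodule by a sub-bimodule. -/
def quot (E : AlgBimod k B A) (K : Submodule k E.carrier)
    (hL : ∀ (b : B), ∀ x ∈ K, b • x ∈ K) (hR : ∀ (a : Aᵐᵒᵖ), ∀ x ∈ K, a • x ∈ K) :
    AlgBimod k B A :=
  letI l : Module B (E.carrier ⧸ K) :=
    { smul := fun b => K.mapQ K (E.lmul b) (hL b)
      one_smul := fun x => by
        induction x using Submodule.Quotient.induction_on with
        | _ x => exact congrArg Submodule.Quotient.mk (one_smul B x)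
      mul_smul := fun b c x => by
        induction x using Submodule.Quotient.induction_on with
        | _ x => exact congrArg Submodule.Quotient.mk (mul_smul b c x)
      smul_zero := fun b => LinearMap.map_zero _
      smul_add := fun b => LinearMap.map_add _
      add_smul := fun b c x => by
        induction x using Submodule.Quotient.induction_on with
        | _ x => exact congrArg Submodule.Quotient.mk (add_smul b c x)
      zero_smul := fun x => by
        induction x using Submodule.Quotient.induction_on with
        | _ x => exact congrArg Submodule.Quotient.mk (zero_smul B x) }
  letI r : Module Aᵐᵒᵖ (E.carrier ⧸ K) :=
    { smul := fun b => K.mapQ K (E.rmul b) (hR b)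
      one_smul := fun x => by
        induction x using Submodule.Quotient.induction_on with
        | _ x => exact congrArg Submodule.Quotient.mk (one_smul Aᵐᵒᵖ x)
      mul_smul := fun b c x => by
        induction x using Submodule.Quotient.induction_on with
        | _ x => exact congrArg Submodule.Quotient.mk (mul_smul b c x)
      smul_zero := fun b => LinearMap.map_zero _
      smul_add := fun b => LinearMap.map_add _
      add_smul := fun b c x => by
        induction x using Submodule.Quotient.induction_on with
        | _ x => exact congrArg Submodule.Quotient.mk (add_smul b c x)
      zero_smul := fun x => by
        induction x using Submodule.Quotient.induction_on with
        | _ x => exact congrArg Submodule.Quotient.mk (zero_smul Aᵐᵒᵖ x) }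
  { carrier := E.carrier ⧸ K
    left := l
    right := r
    comm := ⟨fun b a x => by
      induction x using Submodule.Quotient.induction_on with
      | _ x => exact congrArg Submodule.Quotient.mk (smul_comm b a x)⟩
    towerLeft := ⟨fun c b x => by
      induction x using Submodule.Quotient.induction_on with
      | _ x => exact congrArg Submodule.Quotient.mk (smul_assoc c b x)⟩
    towerRight := ⟨fun c a x => by
      induction x using Submodule.Quotient.induction_on with
      | _ x => exact congrArg Submodule.Quotient.mk (smul_assoc c a x)⟩ }

/-- The tensor product `M ⊗[k] N` over the ground ring, with the left action of `D` on `M` and the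
right action of `A` on `N`. -/
def tensorGround (M : AlgBimod k D B) (N : AlgBimod k B A) : AlgBimod k D A :=
  letI r : Module Aᵐᵒᵖ (M.carrier ⊗[k] N.carrier) :=
    { smul := fun a => (N.rmul a).lTensor M.carrier
      one_smul := fun t => by
        change (N.rmul 1).lTensor M.carrier t = t
        have : N.rmul 1 = LinearMap.id := LinearMap.ext fun x => one_smul Aᵐᵒᵖ x
        rw [this, LinearMap.lTensor_id]; rfl
      mul_smul := fun a b t => by
        change (N.rmul (a * b)).lTensor M.carrier t =
          (N.rmul a).lTensor M.carrier ((N.rmul b).lTensor M.carrier t)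
        have : N.rmul (a * b) = N.rmul a ∘ₗ N.rmul b := LinearMap.ext fun x => mul_smul a b x
        rw [this, LinearMap.lTensor_comp]; rfl
      smul_zero := fun a => LinearMap.map_zero _
      smul_add := fun a => LinearMap.map_add _
      add_smul := fun a b t => by
        change (N.rmul (a + b)).lTensor M.carrier t =
          (N.rmul a).lTensor M.carrier t + (N.rmul b).lTensor M.carrier t
        have : N.rmul (a + b) = N.rmul a + N.rmul b := LinearMap.ext fun x => add_smul a b x
        rw [this, LinearMap.lTensor_add]; rfl
      zero_smul := fun t => by
        change (N.rmul 0).lTensor M.carrier t = 0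
        have : N.rmul 0 = 0 := LinearMap.ext fun x => zero_smul Aᵐᵒᵖ x
        rw [this, LinearMap.lTensor_zero]; rfl }
  { carrier := M.carrier ⊗[k] N.carrier
    right := r
    comm := ⟨fun d a t => by
      change d • (N.rmul a).lTensor M.carrier t = (N.rmul a).lTensor M.carrier (d • t)
      induction t with
      | zero => simp
      | tmul x y => simp [TensorProduct.smul_tmul']
      | add x y hx hy => simp only [map_add, smul_add, hx, hy]⟩
    towerRight := ⟨fun c a t => by
      change (N.rmul (c • a)).lTensor M.carrier t = c • (N.rmul a).lTensor M.carrier t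
      have : N.rmul (c • a) = c • N.rmul a := LinearMap.ext fun x => smul_assoc c a x
      rw [this, LinearMap.lTensor_smul]; rfl⟩ }

/-- The element `m ⊗ n` of `M ⊗[k] N`. -/
def tmulGround (M : AlgBimod k D B) (N : AlgBimod k B A) (m : M.carrier) (n : N.carrier) :
    (M.tensorGround N).carrier :=
  m ⊗ₜ[k] n

theorem tensorGround_induction (M : AlgBimod k D B) (N : AlgBimod k B A)
    {p : (M.tensorGround N).carrier → Prop} (zero : p 0)
    (tmul : ∀ m n, p (M.tmulGround N m n)) (add : ∀ x y, p x → p y → p (x + y))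
    (t : (M.tensorGround N).carrier) : p t :=
  TensorProduct.induction_on (motive := p) t zero tmul add

/-- The submodule of `M ⊗[k] N` generated by the elements `m b ⊗ n - m ⊗ b n`. -/
def balance (M : AlgBimod k D B) (N : AlgBimod k B A) :
    Submodule k (M.tensorGround N).carrier :=
  Submodule.span k {t | ∃ (m : M.carrier) (b : B) (n : N.carrier),
    t = M.tmulGround N (op b • m) n - M.tmulGround N m (b • n)}

theorem balance_left (M : AlgBimod k D B) (N : AlgBimod k B A) (d : D) :
    ∀ t ∈ balance M N, d • t ∈ balance M N := by
  intro t ht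
  refine Submodule.span_induction (p := fun t _ => d • t ∈ balance M N) ?_ ?_ ?_ ?_ ht
  · rintro _ ⟨m, b, n, rfl⟩
    refine Submodule.subset_span ⟨d • m, b, n, ?_⟩
    rw [← smul_comm d (op b) m, smul_sub]; rfl
  · rw [smul_zero]; exact zero_mem _
  · intro x y _ _ hx hy; rw [smul_add]; exact add_mem hx hy
  · intro c x _ hx; rw [smul_comm]; exact Submodule.smul_mem _ c hx

theorem balance_right (M : AlgBimod k D B) (N : AlgBimod k B A) (a : Aᵐᵒᵖ) :
    ∀ t ∈ balance M N, a • t ∈ balance M N := by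
  intro t ht
  refine Submodule.span_induction (p := fun t _ => a • t ∈ balance M N) ?_ ?_ ?_ ?_ ht
  · rintro _ ⟨m, b, n, rfl⟩
    refine Submodule.subset_span ⟨m, b, a • n, ?_⟩
    rw [smul_comm b a n, smul_sub]; rfl
  · rw [smul_zero]; exact zero_mem _
  · intro x y _ _ hx hy; rw [smul_add]; exact add_mem hx hy
  · intro c x _ hx; rw [smul_comm]; exact Submodule.smul_mem _ c hx

/-- The tensor product `M ⊗_B N` of a `(D, B)`-bimodule and a `(B, A)`-bimodule. -/
def tensor (M : AlgBimod k D B) (N : AlgBimod k B A) : AlgBimod k D A :=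
  (M.tensorGround N).quot (balance M N) (balance_left M N) (balance_right M N)

/-- A `(B, A)`-bimodule is invertible, i.e. a ring-theoretic equivalence bimodule, if there is an
`(A, B)`-bimodule `F` with `F ⊗_B E ≅ A` and `E ⊗_A F ≅ B` as bimodules. -/
def Invertible (E : AlgBimod k B A) : Prop :=
  ∃ F : AlgBimod k A B, Iso (F.tensor E) (self k A) ∧ Iso (E.tensor F) (self k B)

theorem twist_aux (Φ : B ≃ₐ[k] B) (E : AlgBimod k B A) (c : k) (b : B) (x : E.carrier) :
    Φ (c • b) • x = c • (Φ b • x) := by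
  rw [map_smul, smul_assoc]

/-- The bimodule `_ΦE`: the same right `A`-module, with left action `b ·_Φ x = Φ b • x`. -/
def twist (Φ : B ≃ₐ[k] B) (E : AlgBimod k B A) : AlgBimod k B A :=
  letI l : Module B E.carrier := Module.compHom E.carrier (Φ : B →+* B)
  { carrier := E.carrier
    left := l
    comm := ⟨fun b a x => smul_comm (Φ b) a x⟩
    towerLeft := ⟨fun c b x => twist_aux Φ E c b x⟩ }

theorem iso_quot_iff (E X : AlgBimod k B A) (K : Submodule k E.carrier)
    (hL : ∀ (b : B), ∀ x ∈ K, b • x ∈ K) (hR : ∀ (a : Aᵐᵒᵖ), ∀ x ∈ K, a • x ∈ K) :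
    Iso (E.quot K hL hR) X ↔ ∃ f : E.carrier →ₗ[k] X.carrier,
      (∀ (b : B) (x : E.carrier), f (b • x) = b • f x) ∧
      (∀ (a : A) (x : E.carrier), f (op a • x) = op a • f x) ∧
      Function.Surjective f ∧ LinearMap.ker f = K := by
  constructor
  · rintro ⟨f, h1, h2⟩
    let g : (E.carrier ⧸ K) ≃ₗ[k] X.carrier := f
    refine ⟨g.toLinearMap ∘ₗ K.mkQ, fun b x => h1 b (Submodule.Quotient.mk (p := K) x),
      fun a x => h2 a (Submodule.Quotient.mk (p := K) x),
      g.surjective.comp K.mkQ_surjective, ?_⟩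
    rw [LinearMap.ker_comp_of_ker_eq_bot _ (LinearEquiv.ker g), Submodule.ker_mkQ]
  · rintro ⟨f, h1, h2, h3, rfl⟩
    let g : (E.carrier ⧸ LinearMap.ker f) ≃ₗ[k] X.carrier := f.quotKerEquivOfSurjective h3
    refine ⟨g, fun b x => ?_, fun a x => ?_⟩
    · obtain ⟨x, rfl⟩ := Submodule.mkQ_surjective (LinearMap.ker f) x
      exact h1 b x
    · obtain ⟨x, rfl⟩ := Submodule.mkQ_surjective (LinearMap.ker f) x
      exact h2 a x

theorem rtwist_aux (Φ : B ≃ₐ[k] B) (F : AlgBimod k A B) (c : k) (b : Bᵐᵒᵖ) (x : F.carrier) :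
    (AlgEquiv.op Φ (c • b)) • x = c • (AlgEquiv.op Φ b • x) := by
  rw [map_smul, smul_assoc]

/-- The right action of a bimodule modified by an automorphism. -/
def rtwist (Φ : B ≃ₐ[k] B) (F : AlgBimod k A B) : AlgBimod k A B :=
  letI r : Module Bᵐᵒᵖ F.carrier := Module.compHom F.carrier (AlgEquiv.op Φ : Bᵐᵒᵖ →+* Bᵐᵒᵖ)
  { carrier := F.carrier
    right := r
    comm := ⟨fun a b x => smul_comm a (AlgEquiv.op Φ b) x⟩
    towerRight := ⟨fun c b x => rtwist_aux Φ F c b x⟩ }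

theorem Invertible.twist (Φ : B ≃ₐ[k] B) {E : AlgBimod k B A} :
    E.Invertible → (E.twist Φ).Invertible := by
  rintro ⟨F, h1, h2⟩
  refine ⟨F.rtwist Φ, ?_, ?_⟩
  · obtain ⟨f, f1, f2, f3, f4⟩ := (iso_quot_iff _ _ _ _ _).1 h1
    refine (iso_quot_iff _ _ _ _ _).2 ⟨f, f1, f2, f3, f4.trans ?_⟩
    refine congrArg (Submodule.span k) (Set.ext fun t => ⟨?_, ?_⟩)
    · rintro ⟨m, b, n, rfl⟩
      refine ⟨m, Φ.symm b, n, ?_⟩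
      change _ = F.tmulGround E (op (Φ (Φ.symm b)) • m) n - F.tmulGround E m (Φ (Φ.symm b) • n)
      rw [AlgEquiv.apply_symm_apply]
    · rintro ⟨m, b, n, rfl⟩
      exact ⟨m, Φ b, n, rfl⟩
  · obtain ⟨f, f1, f2, f3, f4⟩ := (iso_quot_iff _ _ _ _ _).1 h2
    let f' : (E.tensorGround F).carrier →ₗ[k] B := f
    refine (iso_quot_iff _ _ _ _ _).2 ⟨Φ.symm.toLinearMap ∘ₗ f', fun b x => ?_, fun b x => ?_,
      Φ.symm.surjective.comp f3, ?_⟩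
    · refine (congrArg Φ.symm (f1 (Φ b) x)).trans ?_
      change Φ.symm (Φ b * f' x) = b * Φ.symm (f' x)
      rw [map_mul, AlgEquiv.symm_apply_apply]
    · refine (congrArg Φ.symm (f2 (Φ b) x)).trans ?_
      change Φ.symm (f' x * Φ b) = Φ.symm (f' x) * b
      rw [map_mul, AlgEquiv.symm_apply_apply]
    · refine Eq.trans ?_ f4
      ext x
      change Φ.symm (f' x) = 0 ↔ f' x = 0
      simp

theorem Iso.twist (Φ : B ≃ₐ[k] B) {E F : AlgBimod k B A} :
    Iso E F → Iso (E.twist Φ) (F.twist Φ) := by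
  rintro ⟨f, h1, h2⟩
  exact ⟨f, fun b x => h1 (Φ b) x, h2⟩

end

end AlgBimod

section Pic

variable (k : Type v) (B A : Type u) [CommRing k] [Ring B] [Algebra k B] [Ring A] [Algebra k A]

instance AlgBimod.isoSetoid : Setoid {E : AlgBimod k B A // E.Invertible} where
  r E F := AlgBimod.Iso E.1 F.1
  iseqv := ⟨fun E => AlgBimod.Iso.refl E.1, AlgBimod.Iso.symm, AlgBimod.Iso.trans⟩

/-- The set `Pic(B, A)` of isomorphism classes of invertible `(B, A)`-bimodules. -/
def Pic : Type (max v (u + 1)) := Quotient (AlgBimod.isoSetoid k B A)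

/-- The action `(Φ, [E]) ↦ [_ΦE]` of the automorphism group of the unital algebra `B` on
`Pic(B, A)`; since `_Ψ(_ΦE) = _{ΦΨ}E`, it is an action of the opposite group. -/
instance : MulAction (B ≃ₐ[k] B)ᵐᵒᵖ (Pic k B A) where
  smul Φ := Quotient.map (fun E => ⟨E.1.twist Φ.unop, E.2.twist Φ.unop⟩)
    (fun _ _ h => AlgBimod.Iso.twist Φ.unop h)
  one_smul p := by
    induction p using Quotient.inductionOn with
    | _ E => exact Quotient.sound (AlgBimod.Iso.refl E.1)
  mul_smul Φ Ψ p := by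
    induction p using Quotient.inductionOn with
    | _ E => exact Quotient.sound (AlgBimod.Iso.refl (E.1.twist (Ψ.unop * Φ.unop)))

/-- The orbit set `Pic(B, A) / Aut(B)`. -/
abbrev PicModAut : Type (max v (u + 1)) :=
  MulAction.orbitRel.Quotient (B ≃ₐ[k] B)ᵐᵒᵖ (Pic k B A)

/-- Ring-theoretic Morita equivalence of unital algebras. -/
def RingMoritaEquivalent : Prop := ∃ E : AlgBimod k B A, E.Invertible

end Pic

/-! ### Bimodules with inner products -/

/-- A `(B, A)`-bimodule over a commutative `*`-ring `k` together with an `A`-valued inner product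
(`k`-linear and right `A`-linear in the second argument, hermitian) that is compatible with the left
`B`-action. The inner product may be degenerate. -/
structure FormBimod (k : Type v) (B A : Type u) [CommRing k] [StarRing k] [Ring B] [StarRing B]
    [Algebra k B] [Ring A] [StarRing A] [Algebra k A] extends AlgBimod k B A where
  ip : carrier → carrier → A
  ip_add : ∀ x y z, ip x (y + z) = ip x y + ip x z
  ip_smul : ∀ (c : k) x y, ip x (c • y) = c • ip x y
  ip_star : ∀ x y, star (ip x y) = ip y x
  ip_mul : ∀ x y (a : A), ip x (op a • y) = ip x y * a
  ip_compat : ∀ (b : B) x y, ip (b • x) y = ip x (star b • y)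

set_option linter.unusedSectionVars false

namespace FormBimod

section

variable {k : Type v} {D B A : Type u} [CommRing k] [StarRing k]
  [Ring D] [StarRing D] [Algebra k D] [StarModule k D]
  [Ring B] [StarRing B] [Algebra k B] [StarModule k B]
  [Ring A] [StarRing A] [Algebra k A] [StarModule k A]

theorem ip_zero (E : FormBimod k B A) (x : E.carrier) : E.ip x 0 = 0 := by
  simpa using E.ip_smul 0 x 0

theorem ip_add_left (E : FormBimod k B A) (x y z : E.carrier) :
    E.ip (x + y) z = E.ip x z + E.ip y z := by
  rw [← E.ip_star z, E.ip_add, star_add, E.ip_star, E.ip_star]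

theorem ip_smul_left (E : FormBimod k B A) (c : k) (x y : E.carrier) :
    E.ip (c • x) y = star c • E.ip x y := by
  rw [← E.ip_star y, E.ip_smul, star_smul, E.ip_star]

theorem ip_zero_left (E : FormBimod k B A) (x : E.carrier) : E.ip 0 x = 0 := by
  rw [← E.ip_star, ip_zero, star_zero]

theorem ip_mul_left (E : FormBimod k B A) (x y : E.carrier) (a : A) :
    E.ip (op a • x) y = star a * E.ip x y := by
  rw [← E.ip_star y, E.ip_mul, star_mul, E.ip_star]

theorem ip_compat' (E : FormBimod k B A) (b : B) (x y : E.carrier) :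
    E.ip x (b • y) = E.ip (star b • x) y := by
  rw [E.ip_compat, star_star]

/-- Non-degeneracy of the inner product. -/
def Nondegenerate (E : FormBimod k B A) : Prop :=
  ∀ x, (∀ y, E.ip x y = 0) → x = 0

/-- Isomorphism: a bimodule isomorphism preserving the inner products. -/
def Iso (E F : FormBimod k B A) : Prop :=
  ∃ f : E.carrier ≃ₗ[k] F.carrier,
    (∀ (b : B) (x : E.carrier), f (b • x) = b • f x) ∧
    (∀ (a : A) (x : E.carrier), f (op a • x) = op a • f x) ∧
    (∀ x y : E.carrier, F.ip (f x) (f y) = E.ip x y)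

theorem Iso.refl (E : FormBimod k B A) : Iso E E :=
  ⟨LinearEquiv.refl k _, fun _ _ => rfl, fun _ _ => rfl, fun _ _ => rfl⟩

theorem Iso.symm {E F : FormBimod k B A} : Iso E F → Iso F E := by
  rintro ⟨f, h1, h2, h3⟩
  refine ⟨f.symm, fun b x => ?_, fun a x => ?_, fun x y => ?_⟩
  · rw [LinearEquiv.symm_apply_eq, h1, LinearEquiv.apply_symm_apply]
  · rw [LinearEquiv.symm_apply_eq, h2, LinearEquiv.apply_symm_apply]
  · rw [← h3, LinearEquiv.apply_symm_apply, LinearEquiv.apply_symm_apply]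

theorem Iso.trans {E F G : FormBimod k B A} : Iso E F → Iso F G → Iso E G := by
  rintro ⟨f, h1, h2, h3⟩ ⟨g, h4, h5, h6⟩
  exact ⟨f.trans g, fun b x => by simp [h1, h4], fun a x => by simp [h2, h5],
    fun x y => by simp [h3, h6]⟩

/-- The canonical `(A, A)`-bimodule `A` with the inner product `⟨a, b⟩ = a^* b`. -/
def self (k : Type v) (A : Type u) [CommRing k] [StarRing k] [Ring A] [StarRing A] [Algebra k A] :
    FormBimod k A A where
  toAlgBimod := AlgBimod.self k A
  ip := fun a b : A => star a * b
  ip_add := fun a b c : A => mul_add (star a) b c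
  ip_smul := fun c (a b : A) => mul_smul_comm c (star a) b
  ip_star := fun a b : A => by rw [star_mul, star_star]
  ip_mul := fun (a b c : A) => (mul_assoc (star a) b c).symm
  ip_compat := fun (b x y : A) => by
    change star (b * x) * y = star x * (star b * y)
    rw [star_mul, mul_assoc]

/-- The quotient by a sub-bimodule contained in the degeneracy space, with the induced inner
product. -/
def quot (E : FormBimod k B A) (K : Submodule k E.carrier)
    (hL : ∀ (b : B), ∀ x ∈ K, b • x ∈ K) (hR : ∀ (a : Aᵐᵒᵖ), ∀ x ∈ K, a • x ∈ K)
    (hK : ∀ x ∈ K, ∀ y, E.ip x y = 0) : FormBimod k B A where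
  toAlgBimod := E.toAlgBimod.quot K hL hR
  ip := fun s t : E.carrier ⧸ K => Quotient.liftOn₂' s t E.ip (by
    intro x y x' y' h h'
    rw [Submodule.quotientRel_def] at h h'
    have e1 : E.ip x y = E.ip x' y := by
      have := hK _ h y
      rw [sub_eq_add_neg, ← neg_one_smul k x', ip_add_left, ip_smul_left] at this
      simpa [← sub_eq_add_neg, sub_eq_zero] using this
    have e2 : E.ip y x' = E.ip y' x' := by
      have := hK _ h' x'
      rw [sub_eq_add_neg, ← neg_one_smul k y', ip_add_left, ip_smul_left] at this
      simpa [← sub_eq_add_neg, sub_eq_zero] using this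
    rw [e1, ← E.ip_star, e2, E.ip_star])
  ip_add := fun s t r => by
    obtain ⟨x, rfl⟩ := Submodule.mkQ_surjective K s
    obtain ⟨y, rfl⟩ := Submodule.mkQ_surjective K t
    obtain ⟨z, rfl⟩ := Submodule.mkQ_surjective K r
    exact E.ip_add x y z
  ip_smul := fun c s t => by
    obtain ⟨x, rfl⟩ := Submodule.mkQ_surjective K s
    obtain ⟨y, rfl⟩ := Submodule.mkQ_surjective K t
    exact E.ip_smul c x y
  ip_star := fun s t => by
    obtain ⟨x, rfl⟩ := Submodule.mkQ_surjective K s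
    obtain ⟨y, rfl⟩ := Submodule.mkQ_surjective K t
    exact E.ip_star x y
  ip_mul := fun s t a => by
    obtain ⟨x, rfl⟩ := Submodule.mkQ_surjective K s
    obtain ⟨y, rfl⟩ := Submodule.mkQ_surjective K t
    exact E.ip_mul x y a
  ip_compat := fun b s t => by
    obtain ⟨x, rfl⟩ := Submodule.mkQ_surjective K s
    obtain ⟨y, rfl⟩ := Submodule.mkQ_surjective K t
    exact E.ip_compat b x y

/-- The degeneracy space `{x | ⟨x, y⟩ = 0 for all y}`. -/
def degeneracy (E : FormBimod k B A) : Submodule k E.carrier where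
  carrier := {x | ∀ y, E.ip x y = 0}
  add_mem' := fun hx hy z => by rw [ip_add_left, hx z, hy z, add_zero]
  zero_mem' := fun y => ip_zero_left E y
  smul_mem' := fun c x hx y => by rw [ip_smul_left, hx y, smul_zero]

/-- The quotient by the degeneracy space. -/
def reduce (E : FormBimod k B A) : FormBimod k B A :=
  E.quot E.degeneracy (fun b x hx y => by rw [E.ip_compat, hx])
    (fun a x hx y => by
      have := ip_mul_left E x y a.unop
      rw [MulOpposite.op_unop] at this
      rw [this, hx, mul_zero])
    (fun _ hx => hx)

/-- The sesquilinear form on `M ⊗[k] N` determined by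
`⟨y₁ ⊗ x₁, y₂ ⊗ x₂⟩ = ⟨x₁, ⟨y₁, y₂⟩ • x₂⟩`. -/
def tensorForm (M : FormBimod k D B) (N : FormBimod k B A) :
    M.carrier ⊗[k] N.carrier →ₗ⋆[k] M.carrier ⊗[k] N.carrier →ₗ[k] A :=
  TensorProduct.lift (LinearMap.mk₂'ₛₗ (starRingEnd k) (starRingEnd k)
    (fun y₁ x₁ => TensorProduct.lift (LinearMap.mk₂ k
      (fun y₂ x₂ => N.ip x₁ (M.ip y₁ y₂ • x₂))
      (fun y y' x => by rw [M.ip_add, add_smul, N.ip_add])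
      (fun c y x => by rw [M.ip_smul, smul_assoc, N.ip_smul])
      (fun y x x' => by rw [smul_add, N.ip_add])
      (fun c y x => by rw [smul_comm, N.ip_smul])))
    (fun y y' x => TensorProduct.ext' fun y₂ x₂ => by
      simp [ip_add_left, add_smul, N.ip_add])
    (fun c y x => TensorProduct.ext' fun y₂ x₂ => by
      simp [ip_smul_left, smul_assoc, N.ip_smul, starRingEnd_apply])
    (fun y x x' => TensorProduct.ext' fun y₂ x₂ => by
      simp [ip_add_left])
    (fun c y x => TensorProduct.ext' fun y₂ x₂ => by
      simp [ip_smul_left, starRingEnd_apply]))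

theorem tensorForm_tmul (M : FormBimod k D B) (N : FormBimod k B A) (y₁ y₂ : M.carrier)
    (x₁ x₂ : N.carrier) :
    tensorForm M N (y₁ ⊗ₜ[k] x₁) (y₂ ⊗ₜ[k] x₂) = N.ip x₁ (M.ip y₁ y₂ • x₂) := rfl

theorem tensorForm_star (M : FormBimod k D B) (N : FormBimod k B A)
    (s t : M.carrier ⊗[k] N.carrier) : star (tensorForm M N s t) = tensorForm M N t s := by
  induction s with
  | zero => simp
  | add s s' h h' => simp [h, h']
  | tmul y₁ x₁ =>
    induction t with
    | zero => simp
    | add t t' h h' => simp [h, h']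
    | tmul y₂ x₂ =>
      rw [tensorForm_tmul, tensorForm_tmul, N.ip_star, N.ip_compat, M.ip_star]

theorem tensorForm_mul (M : FormBimod k D B) (N : FormBimod k B A)
    (s t : M.carrier ⊗[k] N.carrier) (a : A) :
    tensorForm M N s ((N.rmul (op a)).lTensor M.carrier t) = tensorForm M N s t * a := by
  induction s with
  | zero => simp
  | add s s' h h' => simp [h, h', add_mul]
  | tmul y₁ x₁ =>
    induction t with
    | zero => simp
    | add t t' h h' => simp only [map_add, h, h', add_mul]
    | tmul y₂ x₂ =>
      change N.ip x₁ (M.ip y₁ y₂ • (op a • x₂)) = N.ip x₁ (M.ip y₁ y₂ • x₂) * a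
      rw [smul_comm, N.ip_mul]

theorem tensorForm_compat (M : FormBimod k D B) (N : FormBimod k B A)
    (s t : M.carrier ⊗[k] N.carrier) (d : D) :
    tensorForm M N (d • s) t = tensorForm M N s (star d • t) := by
  induction s with
  | zero => simp
  | add s s' h h' => simp [h, h']
  | tmul y₁ x₁ =>
    induction t with
    | zero => simp
    | add t t' h h' => simp only [map_add, smul_add, h, h']
    | tmul y₂ x₂ =>
      rw [TensorProduct.smul_tmul', TensorProduct.smul_tmul', tensorForm_tmul, tensorForm_tmul,
        M.ip_compat]

/-- `M ⊗[k] N` with the inner product above. -/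
def tensorGround (M : FormBimod k D B) (N : FormBimod k B A) : FormBimod k D A where
  toAlgBimod := M.toAlgBimod.tensorGround N.toAlgBimod
  ip := fun s t => tensorForm M N s t
  ip_add := fun s t r => map_add (tensorForm M N s) t r
  ip_smul := fun c s t => map_smul (tensorForm M N s) c t
  ip_star := tensorForm_star M N
  ip_mul := tensorForm_mul M N
  ip_compat := fun d s t => tensorForm_compat M N s t d

theorem balance_degenerate (M : FormBimod k D B) (N : FormBimod k B A) :
    AlgBimod.balance M.toAlgBimod N.toAlgBimod ≤ (M.tensorGround N).degeneracy := by
  refine Submodule.span_le.2 ?_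
  rintro _ ⟨m, b, n, rfl⟩
  suffices h : ∀ t : M.carrier ⊗[k] N.carrier,
      tensorForm M N ((op b • m) ⊗ₜ[k] n - m ⊗ₜ[k] (b • n)) t = 0 from h
  intro t
  induction t with
  | zero => simp
  | add t t' h h' => rw [map_add, h, h', add_zero]
  | tmul y x =>
    rw [map_sub, LinearMap.sub_apply, tensorForm_tmul, tensorForm_tmul, ip_mul_left, mul_smul,
      ip_compat', star_star, sub_self]

/-- `M ⊗_B N` with the inner product `⟨y₁ ⊗ x₁, y₂ ⊗ x₂⟩ = ⟨x₁, ⟨y₁, y₂⟩ • x₂⟩`. -/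
def tensor (M : FormBimod k D B) (N : FormBimod k B A) : FormBimod k D A :=
  (M.tensorGround N).quot (AlgBimod.balance M.toAlgBimod N.toAlgBimod)
    (AlgBimod.balance_left _ _) (AlgBimod.balance_right _ _) (balance_degenerate M N)

/-- The internal tensor product: `M ⊗_B N` modulo its degeneracy space. -/
def internalTensor (M : FormBimod k D B) (N : FormBimod k B A) : FormBimod k D A :=
  (M.tensor N).reduce

theorem exists_of_iso (M : FormBimod k D B) (N : FormBimod k B A) (X : FormBimod k D A)
    (h : Iso (M.internalTensor N) X) :
    ∃ f : (M.toAlgBimod.tensorGround N.toAlgBimod).carrier →ₗ[k] X.carrier,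
      (∀ (d : D) s, f (d • s) = d • f s) ∧ (∀ (a : A) s, f (op a • s) = op a • f s) ∧
      Function.Surjective f ∧ (∀ s t, X.ip (f s) (f t) = tensorForm M N s t) ∧
      AlgBimod.balance M.toAlgBimod N.toAlgBimod ≤ LinearMap.ker f := by
  obtain ⟨f, h1, h2, h3⟩ := h
  let q₁ := (AlgBimod.balance M.toAlgBimod N.toAlgBimod).mkQ
  let q₂ : (M.tensor N).carrier →ₗ[k] (M.internalTensor N).carrier :=
    (M.tensor N).degeneracy.mkQ
  have s₂ : Function.Surjective q₂ := Submodule.mkQ_surjective _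
  refine ⟨f.toLinearMap ∘ₗ q₂ ∘ₗ q₁, fun d s => h1 d (q₂ (q₁ s)), fun a s => h2 a (q₂ (q₁ s)),
    f.surjective.comp (s₂.comp (Submodule.mkQ_surjective _)),
    fun s t => h3 (q₂ (q₁ s)) (q₂ (q₁ t)), fun x hx => ?_⟩
  have : q₁ x = 0 := (Submodule.Quotient.mk_eq_zero _).2 hx
  change f (q₂ (q₁ x)) = 0
  rw [this]
  exact (congrArg f (map_zero q₂)).trans (map_zero f)

/-- The map `y ⊗ x ↦ ⟨u, y⟩ • x`. -/
def contract (M : FormBimod k D B) (N : FormBimod k B A) (u : M.carrier) :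
    M.carrier ⊗[k] N.carrier →ₗ[k] N.carrier :=
  TensorProduct.lift (LinearMap.mk₂ k (fun y x => M.ip u y • x)
    (fun y y' x => by rw [M.ip_add, add_smul])
    (fun c y x => by rw [M.ip_smul, smul_assoc])
    (fun y x x' => by rw [smul_add])
    (fun c y x => by rw [smul_comm]))

theorem ip_contract (M : FormBimod k D B) (N : FormBimod k B A) (u : M.carrier) (x : N.carrier)
    (t : M.carrier ⊗[k] N.carrier) :
    N.ip x (contract M N u t) = tensorForm M N (u ⊗ₜ[k] x) t := by
  induction t with
  | zero => simp [ip_zero]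
  | add t t' h h' => rw [map_add, N.ip_add, h, h', map_add]
  | tmul y z => rfl

theorem Nondegenerate.ext {E : FormBimod k B A} (hE : E.Nondegenerate) {x y : E.carrier}
    (h : ∀ z, E.ip z x = E.ip z y) : x = y := by
  rw [← sub_eq_zero]
  refine hE _ fun z => ?_
  rw [← E.ip_star, sub_eq_add_neg, ← neg_one_smul k y, E.ip_add, E.ip_smul, h z]
  simp

theorem mem_span_of_isometric (E : FormBimod k B A) (F : FormBimod k A B)
    (hE : E.Nondegenerate) (hF : F.Nondegenerate)
    (f : F.carrier ⊗[k] E.carrier →ₗ[k] A) (g : E.carrier ⊗[k] F.carrier →ₗ[k] B)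
    (f4 : ∀ s t, star (f s) * f t = tensorForm F E s t)
    (g4 : ∀ s t, star (g s) * g t = tensorForm E F s t)
    (s : F.carrier ⊗[k] E.carrier) (hs : f s = 1) (r : E.carrier ⊗[k] F.carrier) (hr : g r = 1)
    (t : F.carrier ⊗[k] E.carrier) (ht : f t = 0) :
    t ∈ Submodule.span k {t : F.carrier ⊗[k] E.carrier |
      ∃ (m : F.carrier) (b : B) (n : E.carrier), t = (op b • m) ⊗ₜ[k] n - m ⊗ₜ[k] (b • n)} := by
  let w : E.carrier → F.carrier := fun x => contract E F x r
  have hw : ∀ x y, g (x ⊗ₜ[k] y) = F.ip (w x) y := fun x y => by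
    rw [← F.ip_star, ip_contract, ← g4, hr, mul_one, star_star]
  have hww : ∀ (x y : E.carrier) (y' : F.carrier),
      E.ip x y • y' = op (F.ip (w y) y') • w x := fun x y y' => by
    refine hF.ext fun z => ?_
    rw [← tensorForm_tmul E F, ← g4, hw, hw, F.ip_star, F.ip_mul]
  obtain ⟨S, hS⟩ := TensorProduct.exists_finset (R := k) (M := F.carrier) (N := E.carrier) s
  have hone : (1 : A) = ∑ j ∈ S, E.ip j.2 (contract F E j.1 s) := by
    have h1 : tensorForm F E s s = 1 := by rw [← f4, hs, star_one, one_mul]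
    have h2 : tensorForm F E s s = tensorForm F E (∑ i ∈ S, i.1 ⊗ₜ[k] i.2) s :=
      congrArg (fun z => tensorForm F E z s) hS
    rw [← h1, h2, map_sum, LinearMap.sum_apply]
    exact Finset.sum_congr rfl fun j _ => (ip_contract F E j.1 j.2 s).symm
  have hdual : ∀ y' : F.carrier,
      y' = ∑ j ∈ S, op (F.ip (w (contract F E j.1 s)) y') • w j.2 := fun y' => by
    conv_lhs => rw [← one_smul A y', hone, Finset.sum_smul]
    exact Finset.sum_congr rfl fun j _ => hww _ _ _
  have hz : ∀ u, contract F E u t = 0 := fun u => hE.ext fun z => by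
    rw [ip_contract, ← f4, ht, mul_zero, ip_zero]
  have key : ∀ t : F.carrier ⊗[k] E.carrier,
      t - ∑ j ∈ S, w j.2 ⊗ₜ[k] contract F E (w (contract F E j.1 s)) t ∈
      Submodule.span k {t : F.carrier ⊗[k] E.carrier |
        ∃ (m : F.carrier) (b : B) (n : E.carrier),
          t = (op b • m) ⊗ₜ[k] n - m ⊗ₜ[k] (b • n)} := by
    intro t
    induction t with
    | zero => simp
    | add t t' h h' =>
      have := add_mem h h'
      simp only [map_add, TensorProduct.tmul_add, Finset.sum_add_distrib]
      convert this using 1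
      abel
    | tmul y x =>
      have e : y ⊗ₜ[k] x = ∑ j ∈ S,
          (op (F.ip (w (contract F E j.1 s)) y) • w j.2) ⊗ₜ[k] x := by
        rw [← TensorProduct.sum_tmul, ← hdual y]
      rw [e, ← Finset.sum_sub_distrib]
      refine sum_mem fun j _ => Submodule.subset_span ⟨w j.2, F.ip (w (contract F E j.1 s)) y, x, ?_⟩
      rw [← e]; rfl
  have := key t
  simpa [hz] using this

/-- If `E` and `F` are mutually inverse for the internal tensor product, then the balanced tensor
product `F ⊗_B E` is already isomorphic to `A`. -/
theorem algIso_of_iso (E : FormBimod k B A) (F : FormBimod k A B) (hE : E.Nondegenerate)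
    (hF : F.Nondegenerate) (h1 : Iso (F.internalTensor E) (self k A))
    (h2 : Iso (E.internalTensor F) (self k B)) :
    AlgBimod.Iso (F.toAlgBimod.tensor E.toAlgBimod) (AlgBimod.self k A) := by
  obtain ⟨f, f1, f2, f3, f4, f5⟩ := exists_of_iso F E _ h1
  obtain ⟨g, -, -, g3, g4, -⟩ := exists_of_iso E F _ h2
  obtain ⟨s, hs⟩ := f3 (1 : A)
  obtain ⟨r, hr⟩ := g3 (1 : B)
  exact (AlgBimod.iso_quot_iff _ _ _ _ _).2 ⟨f, f1, f2, f3,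
    le_antisymm (fun t ht => mem_span_of_isometric E F hE hF f g f4 g4 s hs r hr t ht) f5⟩

end

end FormBimod

/-! ### Positivity over `C = R(i)` -/

/-- The ring `C = R(i)` with `i² = -1` and complex conjugation as involution. -/
abbrev Cx (R : Type v) [CommRing R] : Type v := QuadraticAlgebra R (-1) 0

section Positivity

variable {R : Type v} [CommRing R] [LinearOrder R] {A : Type u} [Ring A] [StarRing A]
  [Algebra (Cx R) A]

/-- The elements of `C = R(i)` that lie in `R` and are nonnegative. -/
def Cx.IsNonneg (z : Cx R) : Prop := 0 ≤ z.re ∧ z.im = 0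

/-- A positive linear functional: `ω (a^* a) ≥ 0` for all `a`. -/
def IsPositiveFunctional (ω : A →ₗ[Cx R] Cx R) : Prop :=
  ∀ a : A, Cx.IsNonneg (ω (star a * a))

/-- An algebra element is positive if all positive linear functionals are nonnegative on it. -/
def IsPositiveElement (R : Type v) [CommRing R] [LinearOrder R] {A : Type u} [Ring A] [StarRing A]
    [Algebra (Cx R) A] (a : A) : Prop :=
  ∀ ω : A →ₗ[Cx R] Cx R, IsPositiveFunctional ω → Cx.IsNonneg (ω a)

/-- A form `h : E × E → A` is completely positive if for all `x₁, …, xₙ` the matrix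
`(h (xᵢ, xⱼ))` is a positive element of `M_n(A)`. -/
def IsCompletelyPositive (R : Type v) [CommRing R] [LinearOrder R] {A : Type u} [Ring A]
    [StarRing A] [Algebra (Cx R) A] {E : Type u} (h : E → E → A) : Prop :=
  ∀ (n : ℕ) (x : Fin n → E),
    IsPositiveElement R (Matrix.of fun i j => h (x i) (x j) : Matrix (Fin n) (Fin n) A)

end Positivity

/-! ### Conditions on unital `*`-algebras -/

section Conditions

variable (R : Type v) [CommRing R] [LinearOrder R] (A B : Type u)
  [Ring A] [StarRing A] [Algebra (Cx R) A] [StarModule (Cx R) A]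
  [Ring B] [StarRing B] [Algebra (Cx R) B] [StarModule (Cx R) B]

/-- Condition (I): `1 + M^* M` is invertible for every square matrix `M` over `A`. -/
def CondI (A : Type u) [Ring A] [StarRing A] : Prop :=
  ∀ (n : ℕ) (M : Matrix (Fin n) (Fin n) A), IsUnit (1 + star M * M)

/-- Condition (II): a positive invertible matrix `H` commuting with a complete family of pairwise
orthogonal projections is `U^* U` for an invertible `U` commuting with these projections. -/
def CondII : Prop :=
  ∀ (n m : ℕ) (P : Fin m → Matrix (Fin n) (Fin n) A) (H : Matrix (Fin n) (Fin n) A),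
    (∀ α, IsStarProjection (P α)) → (∀ α β, α ≠ β → P α * P β = 0) → ∑ α, P α = 1 →
    IsPositiveElement R H → IsUnit H → (∀ α, Commute H (P α)) →
    ∃ U : Matrix (Fin n) (Fin n) A, IsUnit U ∧ H = star U * U ∧ ∀ α, Commute (P α) U

/-- Condition (II⁻): a positive invertible matrix `H` commuting with a projection is `U^* U` for some
`U` commuting with this projection. -/
def CondIIMinus : Prop :=
  ∀ (n : ℕ) (P H : Matrix (Fin n) (Fin n) A),
    IsStarProjection P → IsPositiveElement R H → IsUnit H → Commute P H →
    ∃ U : Matrix (Fin n) (Fin n) A, H = star U * U ∧ Commute P U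

variable {A}

/-- The `*`-algebra `P M_n(A) P` of a projection `P`; its unit is `P`. -/
def corner {n : ℕ} (P : Matrix (Fin n) (Fin n) A) (hP : IsStarProjection P) :
    NonUnitalStarSubalgebra (Cx R) (Matrix (Fin n) (Fin n) A) where
  carrier := {X | P * X * P = X}
  add_mem' := fun {X Y} (hX : P * X * P = X) (hY : P * Y * P = Y) => by
    change P * (X + Y) * P = X + Y
    rw [mul_add, add_mul, hX, hY]
  zero_mem' := by
    change P * 0 * P = 0
    rw [mul_zero, zero_mul]
  mul_mem' := fun {X Y} (hX : P * X * P = X) (hY : P * Y * P = Y) => by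
    change P * (X * Y) * P = X * Y
    have hPP : P * P = P := hP.isIdempotentElem
    have h1 : P * X = X := by rw [← hX, ← mul_assoc, ← mul_assoc, hPP]
    have h2 : Y * P = Y := by rw [← hY, mul_assoc, hPP]
    rw [← mul_assoc, h1, mul_assoc, h2]
  smul_mem' := fun c X (hX : P * X * P = X) => by
    change P * (c • X) * P = c • X
    rw [mul_smul_comm, smul_mul_assoc, hX]
  star_mem' := fun {X} (hX : P * X * P = X) => by
    change P * star X * P = star X
    have hs : star P = P := hP.isSelfAdjoint
    conv_rhs => rw [← hX]
    rw [star_mul, star_mul, hs, mul_assoc]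

variable (A)

/-- Condition (III) for the pair `(A, B)`: whenever `B` and `P M_n(A) P`, with `P` a projection,
are isomorphic as unital algebras, they are `*`-isomorphic. (A multiplicative linear bijection from
`B` onto `P M_n(A) P` maps the unit to the unit.) -/
def CondIII : Prop :=
  ∀ (n : ℕ) (P : Matrix (Fin n) (Fin n) A) (hP : IsStarProjection P),
    (∃ e : B ≃+* corner R P hP, ∀ (c : Cx R) (b : B), e (c • b) = c • e b) →
    Nonempty (B ≃⋆ₐ[Cx R] corner R P hP)

end Conditions

/-! ### Strong Morita equivalence and the strong Picard groupoid -/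

section Strong

variable (R : Type v) [CommRing R] [LinearOrder R] (B A : Type u)
  [Ring B] [StarRing B] [Algebra (Cx R) B] [StarModule (Cx R) B]
  [Ring A] [StarRing A] [Algebra (Cx R) A] [StarModule (Cx R) A]

/-- A strong `(B, A)`-equivalence bimodule. The right linear inner product is `ip`, the left linear
one is `ipL`. The conditions `B · E = E` and `E · A = E` hold automatically, since modules over
unital algebras are unital. -/
structure StrongEquivBimod extends FormBimod (Cx R) B A where
  ip_nondegenerate : ∀ x, (∀ y, ip x y = 0) → x = 0
  ip_full : Submodule.span (Cx R) {a | ∃ x y, a = ip x y} = ⊤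
  ipL : carrier → carrier → B
  ipL_add : ∀ x y z, ipL (x + y) z = ipL x z + ipL y z
  ipL_smul : ∀ (c : Cx R) x y, ipL (c • x) y = c • ipL x y
  ipL_star : ∀ x y, star (ipL x y) = ipL y x
  ipL_mul : ∀ (b : B) x y, ipL (b • x) y = b * ipL x y
  ipL_compat : ∀ (a : A) x y, ipL (op a • x) y = ipL x (op (star a) • y)
  ipL_nondegenerate : ∀ x, (∀ y, ipL x y = 0) → x = 0
  ipL_full : Submodule.span (Cx R) {b | ∃ x y, b = ipL x y} = ⊤
  ip_ipL : ∀ x y z, op (ip y z) • x = ipL x y • z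
  ip_completelyPositive : IsCompletelyPositive R ip
  ipL_completelyPositive : IsCompletelyPositive R ipL

/-- Strong Morita equivalence of unital `*`-algebras. -/
def StrongMoritaEquivalent : Prop := Nonempty (StrongEquivBimod R B A)

variable {R B A}

/-- A pre-Hilbert bimodule: the inner product is non-degenerate and completely positive. -/
def FormBimod.IsPreHilbert (E : FormBimod (Cx R) B A) : Prop :=
  E.Nondegenerate ∧ IsCompletelyPositive R E.ip

/-- A pre-Hilbert `(B, A)`-bimodule is (strongly) invertible if there is a pre-Hilbert
`(A, B)`-bimodule which is inverse to it, up to isomorphism of bimodules with inner products, for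
the internal tensor product. -/
def FormBimod.Invertible (E : FormBimod (Cx R) B A) : Prop :=
  E.IsPreHilbert ∧ ∃ F : FormBimod (Cx R) A B, F.IsPreHilbert ∧
    FormBimod.Iso (F.internalTensor E) (FormBimod.self (Cx R) A) ∧
    FormBimod.Iso (E.internalTensor F) (FormBimod.self (Cx R) B)

theorem FormBimod.Invertible.toAlgBimod {E : FormBimod (Cx R) B A} (h : E.Invertible) :
    E.toAlgBimod.Invertible := by
  obtain ⟨hE, F, hF, h1, h2⟩ := h
  exact ⟨F.toAlgBimod, FormBimod.algIso_of_iso E F hE.1 hF.1 h1 h2,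
    FormBimod.algIso_of_iso F E hF.1 hE.1 h2 h1⟩

variable (R B A)

instance FormBimod.isoSetoid : Setoid {E : FormBimod (Cx R) B A // E.Invertible} where
  r E F := FormBimod.Iso E.1 F.1
  iseqv := ⟨fun E => FormBimod.Iso.refl E.1, FormBimod.Iso.symm, FormBimod.Iso.trans⟩

/-- The set `StrPic(B, A)` of isomorphism classes of invertible pre-Hilbert `(B, A)`-bimodules. -/
def StrPic : Type (max v (u + 1)) := Quotient (FormBimod.isoSetoid R B A)

/-- The canonical map `StrPic(B, A) → Pic(B, A)` forgetting the inner products. -/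
def strPicToPic : StrPic R B A → Pic (Cx R) B A :=
  Quotient.map (fun E => ⟨E.1.toAlgBimod, E.2.toAlgBimod⟩)
    (fun _ _ ⟨f, h1, h2, _⟩ => ⟨f, h1, h2⟩)

/-- The composed map `StrPic(B, A) → Pic(B, A) → Pic(B, A) / Aut(B)`. -/
def strPicToPicModAut (p : StrPic R B A) : PicModAut (Cx R) B A :=
  Quotient.mk _ (strPicToPic R B A p)

end Strong

/-- A (bundled) unital `*`-algebra over `C = R(i)`. -/
structure UnitalStarAlg (R : Type v) [CommRing R] : Type (max v (u + 1)) where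
  carrier : Type u
  [ring : Ring carrier]
  [starRing : StarRing carrier]
  [algebra : Algebra (Cx R) carrier]
  [starModule : StarModule (Cx R) carrier]

attribute [instance] UnitalStarAlg.ring UnitalStarAlg.starRing UnitalStarAlg.algebra
  UnitalStarAlg.starModule

/-! ### Positive elements -/

section PositiveElements

variable {R : Type v} [CommRing R] [LinearOrder R] [IsStrictOrderedRing R] {A : Type u} [Ring A]
  [StarRing A] [Algebra (Cx R) A]

/-! By Morita theory an invertible bimodule `E` is a finitely generated projective generator over
`A`, and `B` is exactly its algebra of right-linear endomorphisms
(`AlgBimod.Invertible.exists_dualBasis`). A dual basis identifies `E` with the range of an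
idempotent matrix in `A^n`. By (I) this idempotent can be traded for a projection `P` with the same
range (`exists_isStarProjection_of_isIdempotentElem`), so `B ≅ P M_n(A) P` as algebras. That
isomorphism need not respect the involutions. Condition (III) supplies a `*`-isomorphism, and the
two differ by an automorphism `Φ` of `B`. Once the left action is twisted by `Φ`, the canonical
inner product of `A^n`, restricted to `E`, is compatible with `B`; this is where the quotient by
`Aut(B)` comes from.

The `B`-valued inner product consists of the rank-one operators `t ↦ y⟨z, t⟩`, which lie in `B`
because all endomorphisms do. Its complete positivity and the fullness of the `A`-valued product
follow once `1 = ∑ ⟨w_j, w_j⟩`. The generator property gives only `1 = ∑ ⟨y_j, z_j⟩`. Polarizing and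
applying (I), the element `∑ ⟨y_j + z_j, y_j + z_j⟩` is invertible, and (II⁻) rescales it to `1`
(`CondIIMinus.exists_normalize`). The result is a strong equivalence bimodule.

Conversely, a strong equivalence bimodule is strongly invertible with its complex conjugate as
inverse, hence invertible in the ring-theoretic sense. So the two relations agree on `K`, and the
ring-theoretic one is an equivalence relation by associativity of the tensor product. -/

theorem isPositiveElement_zero : IsPositiveElement R (0 : A) := fun ω _ => by
  rw [map_zero]; exact ⟨le_rfl, rfl⟩

theorem IsPositiveElement.add {a b : A} (ha : IsPositiveElement R a) (hb : IsPositiveElement R b) :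
    IsPositiveElement R (a + b) := fun ω hω => by
  obtain ⟨h1, h2⟩ := ha ω hω
  obtain ⟨h3, h4⟩ := hb ω hω
  rw [map_add]
  exact ⟨by simpa using add_nonneg h1 h3, by simp [h2, h4]⟩

theorem isPositiveElement_sum {κ : Type*} (s : Finset κ) (a : κ → A)
    (h : ∀ k, IsPositiveElement R (a k)) : IsPositiveElement R (∑ k ∈ s, a k) :=
  Finset.sum_induction a (IsPositiveElement R) (fun _ _ => IsPositiveElement.add)
    isPositiveElement_zero fun k _ => h k

theorem isPositiveElement_star_mul_self (a : A) : IsPositiveElement R (star a * a) :=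
  fun _ hω => hω a

/-- Each summand contributes `M^* M` to the Gram matrix, where `M` has the entries `a k (x j)` in
row `0` and zeros elsewhere. For `n = 0` there is no such row, but then the Gram matrix is empty. -/
theorem isCompletelyPositive_of_eq_sum {E : Type u} {κ : Type*} [Fintype κ] (h : E → E → A)
    (a : κ → E → A) (ha : ∀ x y, h x y = ∑ k, star (a k x) * a k y) :
    IsCompletelyPositive R h := by
  intro n x
  cases n with
  | zero =>
    rw [Subsingleton.elim (Matrix.of fun i j => h (x i) (x j)) 0]
    exact isPositiveElement_zero
  | succ n =>
    let M : κ → Matrix (Fin (n + 1)) (Fin (n + 1)) A :=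
      fun k => Matrix.of fun i j => if i = 0 then a k (x j) else 0
    have e : (Matrix.of fun i j => h (x i) (x j)) = ∑ k, star (M k) * M k := by
      ext i j
      simp [M, ha, Matrix.sum_apply, Matrix.mul_apply, Matrix.star_apply]
    rw [e]
    exact isPositiveElement_sum _ _ fun k => isPositiveElement_star_mul_self _

end PositiveElements

/-! ### Consequences of the conditions on matrices -/

section MatrixConditions

variable {A : Type u} [Ring A] [StarRing A]

/-- With the family as first column of `M`, the matrix `1 + M^* M` is diagonal with corner entry `1
+ ∑ a_k^* a_k` and all other diagonal entries `1`. The corner entry of its inverse is then a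
two-sided inverse. -/
theorem CondI.isUnit_one_add_sum (hI : CondI A) {κ : Type*} [Fintype κ] (a : κ → A) :
    IsUnit (1 + ∑ k, star (a k) * a k) := by
  rw [← (Fintype.equivFin κ).symm.sum_comp]
  generalize hb : (fun i => a ((Fintype.equivFin κ).symm i)) = b
  replace hb := fun i => congrFun hb i
  simp only [hb]
  clear hb
  generalize Fintype.card κ = n at b
  cases n with
  | zero => simp
  | succ n =>
    let M : Matrix (Fin (n + 1)) (Fin (n + 1)) A := Matrix.of fun i j => if j = 0 then b i else 0
    obtain ⟨⟨X, Y, h1, h2⟩, hX : X = _⟩ := hI (n + 1) M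
    have hX0 : ∀ i j, X i j = if i = j then (if i = 0 then 1 + ∑ k, star (b k) * b k else 1)
        else 0 := by
      intro i j
      rw [hX]
      by_cases hij : i = j
      · subst hij
        by_cases hi : i = 0
        · subst hi; simp [M, Matrix.mul_apply, Matrix.star_apply]
        · simp [M, Matrix.mul_apply, Matrix.star_apply, hi]
      · by_cases hi : i = 0
        · subst hi
          simp [M, Matrix.mul_apply, Matrix.star_apply, hij, Ne.symm hij]
        · simp [M, Matrix.mul_apply, Matrix.star_apply, hij, hi]
    have e1 := congrFun (congrFun h1 0) 0
    have e2 := congrFun (congrFun h2 0) 0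
    simp only [Matrix.mul_apply, hX0, ite_mul, mul_ite, zero_mul, mul_zero, Finset.sum_ite_eq,
      Finset.sum_ite_eq', Finset.mem_univ, if_true, Matrix.one_apply_eq] at e1 e2
    exact ⟨⟨_, _, e1, e2⟩, rfl⟩

/-- Kaplansky's formula. The self-adjoint element `h = 1 + (e - e^*)^*(e - e^*)` satisfies `e h = e
e^* e = h e`, so `h` and its inverse commute with `e` and `e^*`. Then `P = e e^* h⁻¹` is a
projection with the same range as `e`. -/
theorem exists_isStarProjection_of_isIdempotentElem {S : Type*} [Ring S] [StarRing S] {e : S}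
    (he : e * e = e) (hu : IsUnit (1 + star (e - star e) * (e - star e))) :
    ∃ P : S, IsStarProjection P ∧ P * e = e ∧ e * P = P := by
  obtain ⟨⟨h, g, hg, gh⟩, hh : h = _⟩ := hu
  have he' : star e * star e = star e := by rw [← star_mul, he]
  have heh : e * h = e * star e * e := by
    rw [hh, star_sub, star_star]
    simp only [mul_add, mul_sub, sub_mul, mul_one, ← mul_assoc, he, he']
    abel
  have hhe : h * e = e * star e * e := by
    rw [hh, star_sub, star_star]
    simp only [add_mul, mul_sub, sub_mul, one_mul, mul_assoc, he, he']
    abel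
  have hs : star h = h := by
    rw [hh, star_add, star_mul, star_star, star_one]
  have hc : Commute e h := heh.trans hhe.symm
  have hc' : Commute (star e) h := by
    have := hc.star_star; rwa [hs] at this
  have gcomm : ∀ x : S, Commute x h → Commute x g := fun x hx => by
    change x * g = g * x
    calc x * g = g * h * (x * g) := by rw [gh, one_mul]
      _ = g * (h * x) * g := by simp only [mul_assoc]
      _ = g * x * (h * g) := by rw [← hx.eq]; simp only [mul_assoc]
      _ = g * x := by rw [hg, mul_one]
  have ge := gcomm e hc
  have ge' := gcomm (star e) hc'
  have gs : star g = g := by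
    calc star g = star g * (h * g) := by rw [hg, mul_one]
      _ = star (h * g) * g := by rw [star_mul, hs, mul_assoc]
      _ = g := by rw [hg, star_one, one_mul]
  refine ⟨e * star e * g, ⟨?_, ?_⟩, ?_, ?_⟩
  · change e * star e * g * (e * star e * g) = _
    calc e * star e * g * (e * star e * g) = e * star e * (g * e) * star e * g := by
          simp only [mul_assoc]
      _ = (e * star e * e) * (g * star e) * g := by rw [← ge.eq]; simp only [mul_assoc]
      _ = e * (h * star e) * g * g := by rw [← heh, ← ge'.eq]; simp only [mul_assoc]
      _ = e * star e * (h * g) * g := by rw [← hc'.eq]; simp only [mul_assoc]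
      _ = _ := by rw [hg, mul_one]
  · change star (e * star e * g) = _
    rw [star_mul, star_mul, star_star, gs, ← mul_assoc, ← ge.eq, mul_assoc, ← ge'.eq, mul_assoc]
  · rw [mul_assoc, ← ge.eq, ← mul_assoc, ← heh, mul_assoc, hg, mul_one]
  · rw [← mul_assoc, ← mul_assoc, he]

variable {R : Type v} [CommRing R] [LinearOrder R] [IsStrictOrderedRing R] [Algebra (Cx R) A]
  [StarModule (Cx R) A]

/-- The complete orthogonal family here is `P, 1 - P`. -/
theorem CondII.condIIMinus (h : CondII R A) : CondIIMinus R A := by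
  intro n P H hP hH hHu hPH
  have hPP : P * P = P := hP.isIdempotentElem
  obtain ⟨U, -, h1, h2⟩ := h n 2 ![P, 1 - P] H
    (by intro α; fin_cases α; exacts [hP, hP.one_sub])
    (by
      intro α β hαβ
      fin_cases α <;> fin_cases β <;> simp_all [mul_sub, sub_mul])
    (by simp) hH hHu
    (by
      intro α; fin_cases α
      exacts [hPH.symm, (Commute.one_right H).sub_right hPH.symm])
  exact ⟨U, h1, h2 0⟩

open Matrix in
-- Applied to `s` itself, (II⁻) gives `s = u^* u`, but the choice `c = u⁻¹` is not available, since
-- `u` is not asserted to be invertible. Instead `V` embeds `A`, with the form `a^* s b`,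
-- isometrically onto the range of the projection `e = V s⁻¹ Vᴴ`. There `V Vᴴ` acts as
-- multiplication by `s`. Its factorization `U^* U`, with `U` preserving the range, becomes `u^* s u
-- = s²` for `u = s⁻¹ Vᴴ U V`, so `c = u s⁻¹` works without inverting `u`.
theorem CondIIMinus.exists_normalize_fin (hII : CondIIMinus R A) {n : ℕ} (V : Matrix (Fin n) Unit A)
    (s t : Matrix Unit Unit A) (hs : Vᴴ * V = s) (hst : s * t = 1) (hts : t * s = 1) :
    ∃ c : Matrix Unit Unit A, cᴴ * s * c = 1 := by
  have ss : sᴴ = s := by rw [← hs, conjTranspose_mul, conjTranspose_conjTranspose]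
  have tt : tᴴ = t := by
    calc tᴴ = tᴴ * (s * t) := by rw [hst, mul_one]
      _ = (s * t)ᴴ * t := by rw [conjTranspose_mul, ss, Matrix.mul_assoc]
      _ = t := by rw [hst, conjTranspose_one, one_mul]
  set e : Matrix (Fin n) (Fin n) A := V * t * Vᴴ with he
  have eV : e * V = V := by
    rw [he, Matrix.mul_assoc, hs, Matrix.mul_assoc, hts, Matrix.mul_one]
  have es : eᴴ = e := by
    rw [he, conjTranspose_mul, conjTranspose_mul, conjTranspose_conjTranspose, tt,
      Matrix.mul_assoc]
  have Ve : Vᴴ * e = Vᴴ := by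
    have := congrArg conjTranspose eV
    rwa [conjTranspose_mul, es] at this
  have ee : e * e = e := by
    conv_lhs => rw [he, Matrix.mul_assoc, Ve]
  have hproj : IsStarProjection e := ⟨ee, es⟩
  -- The summand `1 - e` makes `H` invertible on the complement of the range of `e` without
  -- affecting the range.
  set H : Matrix (Fin n) (Fin n) A := V * Vᴴ + (1 - e) with hH
  have e1 : e * (1 - e) = 0 := by rw [mul_sub, mul_one, ee, sub_self]
  have e2 : (1 - e) * e = 0 := by rw [sub_mul, one_mul, ee, sub_self]
  have e3 : (1 - e) * (1 - e) = 1 - e := by rw [mul_sub, mul_one, e2, sub_zero]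
  have V1 : Vᴴ * (1 - e) = 0 := by rw [Matrix.mul_sub, Ve, Matrix.mul_one, sub_self]
  have V2 : (1 - e) * V = 0 := by rw [Matrix.sub_mul, eV, Matrix.one_mul, sub_self]
  have hpos : IsPositiveElement R H := by
    refine IsPositiveElement.add ?_ ?_
    · cases n with
      | zero => rw [Subsingleton.elim (V * Vᴴ) 0]; exact isPositiveElement_zero
      | succ n =>
        have : V * Vᴴ = star (Matrix.of fun i j => if i = 0 then star (V j ()) else 0 :
            Matrix (Fin (n + 1)) (Fin (n + 1)) A) *
            (Matrix.of fun i j => if i = 0 then star (V j ()) else 0) := by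
          ext i j
          simp [Matrix.mul_apply, Matrix.star_apply]
        rw [this]
        exact isPositiveElement_star_mul_self _
    · have : 1 - e = star (1 - e) * (1 - e) := by
        rw [star_sub, star_one, star_eq_conjTranspose, es, e3]
      rw [this]
      exact isPositiveElement_star_mul_self _
  -- `V t t Vᴴ` is the inverse of `V Vᴴ` in the corner of `e`.
  have key1 : V * Vᴴ * (V * t * t * Vᴴ) = e := by
    calc V * Vᴴ * (V * t * t * Vᴴ) = V * ((Vᴴ * V) * t) * t * Vᴴ := by
          simp only [Matrix.mul_assoc]
      _ = e := by rw [hs, hst, Matrix.mul_one]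
  have key2 : (V * t * t * Vᴴ) * (V * Vᴴ) = e := by
    calc (V * t * t * Vᴴ) * (V * Vᴴ) = V * t * (t * (Vᴴ * V)) * Vᴴ := by
          simp only [Matrix.mul_assoc]
      _ = e := by rw [hs, hts, Matrix.mul_one]
  have hunit : IsUnit H := by
    refine ⟨⟨H, V * t * t * Vᴴ + (1 - e), ?_, ?_⟩, rfl⟩
    · rw [hH, add_mul, mul_add, mul_add, key1, e3, Matrix.mul_assoc V, V1, Matrix.mul_zero,
        ← Matrix.mul_assoc (1 - e), ← Matrix.mul_assoc (1 - e), ← Matrix.mul_assoc (1 - e), V2]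
      simp
    · rw [hH, add_mul, mul_add, mul_add, key2, e3, Matrix.mul_assoc _ Vᴴ, V1, Matrix.mul_zero,
        ← Matrix.mul_assoc (1 - e), V2]
      simp
  have hcomm : Commute e H := by
    change e * H = H * e
    rw [hH, mul_add, add_mul, e1, e2, ← Matrix.mul_assoc, eV, Matrix.mul_assoc, Ve]
  obtain ⟨U, hU, hUe⟩ := hII n e H hproj hpos hunit hcomm
  set w : Matrix (Fin n) Unit A := U * V * t with hw
  -- Since `U` commutes with `e`, the column `w` stays in the range of `V`, and `t Vᴴ w` is its
  -- coordinate there.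
  have ew : V * (t * Vᴴ * w) = w := by
    calc V * (t * Vᴴ * w) = e * w := by rw [he]; simp only [Matrix.mul_assoc]
      _ = (e * U) * V * t := by rw [hw]; simp only [Matrix.mul_assoc]
      _ = U * (e * V) * t := by rw [hUe.eq]; simp only [Matrix.mul_assoc]
      _ = w := by rw [eV]
  refine ⟨t * Vᴴ * w, ?_⟩
  calc (t * Vᴴ * w)ᴴ * s * (t * Vᴴ * w)
      = (V * (t * Vᴴ * w))ᴴ * (V * (t * Vᴴ * w)) := by
        rw [← hs, conjTranspose_mul V]; simp only [Matrix.mul_assoc]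
    _ = wᴴ * w := by rw [ew]
    _ = t * (Vᴴ * (Uᴴ * U) * V) * t := by
        rw [hw, conjTranspose_mul, conjTranspose_mul, tt]; simp only [Matrix.mul_assoc]
    _ = t * (s * s) * t := by
        rw [← star_eq_conjTranspose U, ← hU, hH, Matrix.mul_add, V1, add_zero, ← hs]
        simp only [Matrix.mul_assoc]
    _ = 1 := by rw [← Matrix.mul_assoc t, hts, Matrix.one_mul, hst]

/-- A sum of squares that is invertible can be normalized to the unit. -/
theorem CondIIMinus.exists_normalize (hII : CondIIMinus R A) {ι : Type*} [Fintype ι] (v : ι → A)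
    (hS : IsUnit (∑ i, star (v i) * v i)) : ∃ c : A, star c * (∑ i, star (v i) * v i) * c = 1 := by
  obtain ⟨⟨s, t, hst, hts⟩, hs : s = _⟩ := hS
  rw [← hs]
  obtain ⟨c, hc⟩ := hII.exists_normalize_fin
    (Matrix.of fun i _ => v ((Fintype.equivFin ι).symm i)) (Matrix.of fun _ _ => s)
    (Matrix.of fun _ _ => t)
    (by
      ext i j
      simp only [Matrix.mul_apply, Matrix.conjTranspose_apply, Matrix.of_apply]
      rw [hs, ← (Fintype.equivFin ι).symm.sum_comp])
    (by ext i j; simp [Matrix.mul_apply, hst])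
    (by ext i j; simp [Matrix.mul_apply, hts])
  refine ⟨c () (), ?_⟩
  simpa [Matrix.mul_apply] using congrFun (congrFun hc ()) ()

end MatrixConditions

/-! ### Tensor products of bimodules -/

namespace AlgBimod

section TensorProducts

variable {k : Type v} {D' D B A : Type u} [CommRing k] [Ring D'] [Algebra k D'] [Ring D]
  [Algebra k D] [Ring B] [Algebra k B] [Ring A] [Algebra k A]

/-- The element `m ⊗ n` of `M ⊗_B N`, as a bilinear map. -/
def tmul (M : AlgBimod k D B) (N : AlgBimod k B A) :
    M.carrier →ₗ[k] N.carrier →ₗ[k] (M.tensor N).carrier :=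
  (TensorProduct.mk k M.carrier N.carrier).compr₂
    ((balance M N).mkQ : M.carrier ⊗[k] N.carrier →ₗ[k] (M.tensor N).carrier)

variable (M : AlgBimod k D B) (N : AlgBimod k B A)

theorem tmul_balanced (m : M.carrier) (b : B) (n : N.carrier) :
    tmul M N (op b • m) n = tmul M N m (b • n) :=
  (Submodule.Quotient.eq (balance M N)).2 (Submodule.subset_span ⟨m, b, n, rfl⟩)

theorem smul_tmul (d : D) (m : M.carrier) (n : N.carrier) : d • tmul M N m n = tmul M N (d • m) n := rfl

theorem op_smul_tmul (a : A) (m : M.carrier) (n : N.carrier) :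
    op a • tmul M N m n = tmul M N m (op a • n) := rfl

variable {M N}

@[elab_as_elim]
theorem tensor_induction {p : (M.tensor N).carrier → Prop} (zero : p 0)
    (pure : ∀ m n, p (tmul M N m n)) (add : ∀ x y, p x → p y → p (x + y))
    (t : (M.tensor N).carrier) : p t := by
  obtain ⟨t, rfl⟩ : ∃ s : M.carrier ⊗[k] N.carrier,
    ((balance M N).mkQ : M.carrier ⊗[k] N.carrier →ₗ[k] (M.tensor N).carrier) s = t :=
    Submodule.mkQ_surjective (balance M N) t
  induction t with
  | zero => exact zero
  | tmul m n => exact pure m n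
  | add s t hs ht => exact add _ _ hs ht

/-- The linear map on `M ⊗_B N` induced by a balanced bilinear map. -/
def lift {X : Type*} [AddCommGroup X] [Module k X] (f : M.carrier →ₗ[k] N.carrier →ₗ[k] X)
    (hf : ∀ m (b : B) n, f (op b • m) n = f m (b • n)) : (M.tensor N).carrier →ₗ[k] X :=
  (balance M N).liftQ (TensorProduct.lift f : M.carrier ⊗[k] N.carrier →ₗ[k] X)
    (Submodule.span_le.2 (by
      rintro _ ⟨m, b, n, rfl⟩
      change TensorProduct.lift f ((op b • m) ⊗ₜ[k] n - m ⊗ₜ[k] (b • n)) = 0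
      rw [map_sub, TensorProduct.lift.tmul, TensorProduct.lift.tmul, hf, sub_self]))

@[simp]
theorem lift_tmul {X : Type*} [AddCommGroup X] [Module k X]
    (f : M.carrier →ₗ[k] N.carrier →ₗ[k] X)
    (hf : ∀ m (b : B) n, f (op b • m) n = f m (b • n)) (m : M.carrier) (n : N.carrier) :
    lift f hf (tmul M N m n) = f m n := rfl

/-- Bimodules are isomorphic if there are mutually inverse linear maps, one of them compatible with
the actions. -/
theorem Iso.of_inverse {E F : AlgBimod k B A} (f : E.carrier →ₗ[k] F.carrier)
    (g : F.carrier →ₗ[k] E.carrier) (hgf : ∀ x, g (f x) = x) (hfg : ∀ y, f (g y) = y)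
    (hl : ∀ (b : B) x, f (b • x) = b • f x) (hr : ∀ (a : A) x, f (op a • x) = op a • f x) :
    Iso E F :=
  ⟨LinearEquiv.ofLinearMap f g (LinearMap.ext hfg) (LinearMap.ext hgf), hl, hr⟩

theorem Iso.tensor {M' : AlgBimod k D B} {N' : AlgBimod k B A} (hM : Iso M M') (hN : Iso N N') :
    Iso (M.tensor N) (M'.tensor N') := by
  obtain ⟨f, f1, f2⟩ := hM
  obtain ⟨g, g1, g2⟩ := hN
  have f2' : ∀ (b : B) x, f.symm (op b • x) = op b • f.symm x := fun b x => by
    rw [LinearEquiv.symm_apply_eq, f2, LinearEquiv.apply_symm_apply]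
  have g1' : ∀ (b : B) x, g.symm (b • x) = b • g.symm x := fun b x => by
    rw [LinearEquiv.symm_apply_eq, g1, LinearEquiv.apply_symm_apply]
  refine Iso.of_inverse
    (lift ((tmul M' N').compl₁₂ f.toLinearMap g.toLinearMap)
      fun m b n => by simp [f2, g1, tmul_balanced])
    (lift ((tmul M N).compl₁₂ f.symm.toLinearMap g.symm.toLinearMap)
      fun m b n => by simp [f2', g1', tmul_balanced]) ?_ ?_ ?_ ?_
  · intro x
    induction x using tensor_induction with
    | zero => simp
    | pure m n => simp
    | add x y hx hy => simp only [map_add, hx, hy]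
  · intro x
    induction x using tensor_induction with
    | zero => simp
    | pure m n => simp
    | add x y hx hy => simp only [map_add, hx, hy]
  · intro b x
    induction x using tensor_induction with
    | zero => simp
    | pure m n => rw [smul_tmul]; simp [f1, smul_tmul]
    | add x y hx hy => simp only [map_add, smul_add, hx, hy]
  · intro b x
    induction x using tensor_induction with
    | zero => simp
    | pure m n => rw [op_smul_tmul]; simp [g2, op_smul_tmul]
    | add x y hx hy => simp only [map_add, smul_add, hx, hy]

theorem Iso.self_tensor (N : AlgBimod k B A) : Iso ((self k B).tensor N) N := by
  let a : (self k B).carrier →ₗ[k] N.carrier →ₗ[k] N.carrier :=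
    LinearMap.mk₂ k (fun (b : B) x => b • x) (fun b c x => add_smul (R := B) b c x)
      (fun c b x => smul_assoc (N := B) c b x) (fun b x y => smul_add (M := B) b x y)
      (fun c b x => smul_comm (M := B) b c x)
  have htmul : ∀ (b : B) x, tmul (self k B) N b x = tmul (self k B) N (1 : B) (b • x) := fun b x => by
    refine Eq.trans ?_ (tmul_balanced (self k B) N (1 : B) b x)
    exact congrArg (fun c : B => tmul (self k B) N c x) (one_mul b).symm
  refine Iso.of_inverse (lift a fun (m : B) b n => ?_) (tmul (self k B) N (1 : B)) ?_ ?_ ?_ ?_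
  · exact mul_smul m b n
  · intro x
    induction x using tensor_induction with
    | zero => simp
    | pure m n => exact (htmul m n).symm
    | add x y hx hy => simp only [map_add, hx, hy]
  · exact fun y => one_smul B y
  · intro b x
    induction x using tensor_induction with
    | zero => simp
    | pure m n => exact mul_smul b (m : B) n
    | add x y hx hy => simp only [map_add, smul_add, hx, hy]
  · intro b x
    induction x using tensor_induction with
    | zero => simp
    | pure m n => exact smul_comm (M := B) m (op b) n
    | add x y hx hy => simp only [map_add, smul_add, hx, hy]

/-- Both sides classify balanced trilinear maps. Each direction is obtained by lifting twice, and
all identities are checked on pure tensors. -/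
theorem Iso.assoc (L : AlgBimod k D' D) (M : AlgBimod k D B) (N : AlgBimod k B A) :
    Iso ((L.tensor M).tensor N) (L.tensor (M.tensor N)) := by
  let f₀ : L.carrier →ₗ[k] M.carrier →ₗ[k] N.carrier →ₗ[k] (L.tensor (M.tensor N)).carrier :=
    LinearMap.mk₂ k (fun l m => tmul L (M.tensor N) l ∘ₗ tmul M N m)
      (fun l l' m => by ext; simp) (fun c l m => by ext; simp)
      (fun l m m' => by ext; simp) (fun c l m => by ext; simp)
  have f₀_apply : ∀ l m n, f₀ l m n = tmul L (M.tensor N) l (tmul M N m n) := fun _ _ _ => rfl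
  let f₁ : (L.tensor M).carrier →ₗ[k] N.carrier →ₗ[k] (L.tensor (M.tensor N)).carrier :=
    lift f₀ fun l d m => by
      ext n
      rw [f₀_apply, f₀_apply, tmul_balanced, smul_tmul]
  have f₁_apply : ∀ l m n, f₁ (tmul L M l m) n = tmul L (M.tensor N) l (tmul M N m n) :=
    fun _ _ _ => rfl
  let f : ((L.tensor M).tensor N).carrier →ₗ[k] (L.tensor (M.tensor N)).carrier :=
    lift f₁ fun s b n => by
      induction s using tensor_induction with
      | zero => simp
      | pure l m => rw [op_smul_tmul, f₁_apply, f₁_apply, tmul_balanced]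
      | add x y hx hy => simp only [map_add, smul_add, LinearMap.add_apply, hx, hy]
  have f_apply : ∀ l m n, f (tmul _ N (tmul L M l m) n) = tmul L (M.tensor N) l (tmul M N m n) :=
    fun _ _ _ => rfl
  let g₁ : L.carrier →ₗ[k] (M.tensor N).carrier →ₗ[k] ((L.tensor M).tensor N).carrier :=
    { toFun := fun l => lift (tmul (L.tensor M) N ∘ₗ tmul L M l) fun m b n => by
        simp only [LinearMap.comp_apply]
        rw [← op_smul_tmul, tmul_balanced]
      map_add' := fun l l' => LinearMap.ext fun s => by
        induction s using tensor_induction with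
        | zero => simp
        | pure l m => simp
        | add x y hx hy =>
          exact (map_add _ x y).trans ((congrArg₂ _ hx hy).trans (map_add _ x y).symm)
      map_smul' := fun c l => LinearMap.ext fun s => by
        induction s using tensor_induction with
        | zero => simp
        | pure l m => simp
        | add x y hx hy => simp only [map_add, hx, hy] }
  have g₁_apply : ∀ l m n, g₁ l (tmul M N m n) = tmul (L.tensor M) N (tmul L M l m) n :=
    fun _ _ _ => rfl
  let g : (L.tensor (M.tensor N)).carrier →ₗ[k] ((L.tensor M).tensor N).carrier :=
    lift g₁ fun l d s => by
      induction s using tensor_induction with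
      | zero => simp
      | pure m n => rw [smul_tmul, g₁_apply, g₁_apply, tmul_balanced]
      | add x y hx hy => simp only [map_add, smul_add, hx, hy]
  have g_apply : ∀ l m n, g (tmul L (M.tensor N) l (tmul M N m n)) = tmul _ N (tmul L M l m) n :=
    fun _ _ _ => rfl
  refine Iso.of_inverse f g ?_ ?_ ?_ ?_
  · intro x
    induction x using tensor_induction with
    | zero => simp
    | add x y hx hy => simp only [map_add, hx, hy]
    | pure s n =>
      induction s using tensor_induction with
      | zero => simp
      | add x y hx hy => simp only [map_add, LinearMap.add_apply, hx, hy]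
      | pure l m => rw [f_apply, g_apply]
  · intro x
    induction x using tensor_induction with
    | zero => simp
    | add x y hx hy => simp only [map_add, hx, hy]
    | pure l s =>
      induction s using tensor_induction with
      | zero => simp
      | add x y hx hy => simp only [map_add, hx, hy]
      | pure m n => rw [g_apply, f_apply]
  · intro d x
    induction x using tensor_induction with
    | zero => simp
    | add x y hx hy => simp only [map_add, smul_add, hx, hy]
    | pure s n =>
      induction s using tensor_induction with
      | zero => simp
      | add x y hx hy => simp only [map_add, LinearMap.add_apply, smul_add, hx, hy]
      | pure l m => rfl
  · intro d x
    induction x using tensor_induction with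
    | zero => simp
    | add x y hx hy => simp only [map_add, smul_add, hx, hy]
    | pure s n =>
      induction s using tensor_induction with
      | zero => simp
      | add x y hx hy => simp only [map_add, LinearMap.add_apply, smul_add, hx, hy]
      | pure l m => rfl

/-- The inner pair `H ⊗ G` collapses to the unit bimodule first, then `F ⊗ E` does. By symmetry this
serves both sides of the inverse of a tensor product. -/
theorem Iso.tensor_tensor_self {E : AlgBimod k B A} {F : AlgBimod k A B} {G : AlgBimod k D B}
    {H : AlgBimod k B D} (h1 : Iso (F.tensor E) (self k A)) (h2 : Iso (H.tensor G) (self k B)) :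
    Iso ((F.tensor H).tensor (G.tensor E)) (self k A) :=
  ((Iso.assoc F H (G.tensor E)).trans
    ((Iso.refl F).tensor ((Iso.assoc H G E).symm.trans
      ((h2.tensor (Iso.refl E)).trans (Iso.self_tensor E))))).trans h1

theorem Invertible.tensor {G : AlgBimod k D B} {E : AlgBimod k B A} (hG : G.Invertible)
    (hE : E.Invertible) : (G.tensor E).Invertible := by
  obtain ⟨F, h1, h2⟩ := hE
  obtain ⟨H, h3, h4⟩ := hG
  exact ⟨F.tensor H, h1.tensor_tensor_self h3, h4.tensor_tensor_self h2⟩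

theorem invertible_self (A : Type u) [Ring A] [Algebra k A] : (self k A).Invertible :=
  ⟨self k A, Iso.self_tensor _, Iso.self_tensor _⟩

end TensorProducts

end AlgBimod

/-! ### Ring-theoretic Morita equivalence is an equivalence relation -/

section RingMorita

variable {k : Type v} {D B A : Type u} [CommRing k] [Ring D] [Algebra k D] [Ring B] [Algebra k B]
  [Ring A] [Algebra k A]

theorem RingMoritaEquivalent.refl (A : Type u) [Ring A] [Algebra k A] :
    RingMoritaEquivalent k A A := ⟨_, AlgBimod.invertible_self A⟩

theorem RingMoritaEquivalent.symm (h : RingMoritaEquivalent k B A) :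
    RingMoritaEquivalent k A B := by
  obtain ⟨E, F, h1, h2⟩ := h
  exact ⟨F, E, h2, h1⟩

theorem RingMoritaEquivalent.trans (h : RingMoritaEquivalent k D B)
    (h' : RingMoritaEquivalent k B A) : RingMoritaEquivalent k D A := by
  obtain ⟨G, hG⟩ := h
  obtain ⟨E, hE⟩ := h'
  exact ⟨_, hG.tensor hE⟩

end RingMorita

/-! ### The structure of invertible bimodules -/

namespace AlgBimod

section Frames

variable {k : Type v} {D B A : Type u} [CommRing k] [Ring D] [Algebra k D] [Ring B] [Algebra k B]
  [Ring A] [Algebra k A]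

/-- An isomorphism `M ⊗_B N ≅ D` as a balanced pairing which represents the unit and through which
all balanced bilinear maps factor. -/
theorem Iso.exists_pairing {M : AlgBimod k D B} {N : AlgBimod k B D}
    (h : Iso (M.tensor N) (self k D)) :
    ∃ f : M.carrier →ₗ[k] N.carrier →ₗ[k] D,
      (∀ m (b : B) n, f (op b • m) n = f m (b • n)) ∧
      (∀ (d : D) m n, f (d • m) n = d * f m n) ∧
      (∀ (d : D) m n, f m (op d • n) = f m n * d) ∧
      (∃ (r : ℕ) (y : Fin r → M.carrier) (x : Fin r → N.carrier), ∑ j, f (y j) (x j) = 1) ∧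
      ∀ p : M.carrier →ₗ[k] N.carrier →ₗ[k] N.carrier,
        (∀ m (b : B) n, p (op b • m) n = p m (b • n)) →
        ∃ q : D →ₗ[k] N.carrier, ∀ m n, p m n = q (f m n) := by
  obtain ⟨e₀, h1, h2⟩ := h
  let e : (M.tensor N).carrier ≃ₗ[k] D := e₀
  have hfin : ∀ t : (M.tensor N).carrier, ∃ (r : ℕ) (y : Fin r → M.carrier)
      (x : Fin r → N.carrier), ∑ j, tmul M N (y j) (x j) = t := by
    intro t
    induction t using tensor_induction with
    | zero => exact ⟨0, Fin.elim0, Fin.elim0, rfl⟩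
    | pure m n => exact ⟨1, fun _ => m, fun _ => n, by simp⟩
    | add s t hs ht =>
      obtain ⟨r, y, x, rfl⟩ := hs
      obtain ⟨r', y', x', rfl⟩ := ht
      exact ⟨r + r', Fin.append y y', Fin.append x x', by simp [Fin.sum_univ_add]⟩
  refine ⟨(tmul M N).compr₂ e.toLinearMap, fun m b n => ?_, fun d m n => h1 d (tmul M N m n),
    fun d m n => h2 d (tmul M N m n), ?_, fun p hp => ⟨lift p hp ∘ₗ e.symm.toLinearMap,
    fun m n => ?_⟩⟩
  · exact congrArg e (tmul_balanced M N m b n)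
  · obtain ⟨r, y, x, hr⟩ := hfin (e.symm 1)
    refine ⟨r, y, x, ?_⟩
    have := congrArg e hr
    rwa [map_sum, e.apply_symm_apply] at this
  · change p m n = lift p hp (e.symm (e (tmul M N m n)))
    rw [e.symm_apply_apply, lift_tmul]

/-- An invertible bimodule is, as a right module, finitely generated projective (with a dual basis)
and a generator, and the left action identifies `B` with the endomorphisms of this right module. -/
theorem Invertible.exists_dualBasis {E : AlgBimod k B A} (hE : E.Invertible) :
    (∃ (n : ℕ) (x : Fin n → E.carrier) (φ : Fin n → E.carrier →ₗ[Aᵐᵒᵖ] A),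
      ∀ z, ∑ i, op (φ i z) • x i = z) ∧
    (∃ (m : ℕ) (u : Fin m → E.carrier) (ψ : Fin m → E.carrier →ₗ[Aᵐᵒᵖ] A),
      ∑ j, ψ j (u j) = 1) ∧
    (∀ b : B, (∀ z : E.carrier, b • z = 0) → b = 0) ∧
    (∀ T : E.carrier →ₗ[Aᵐᵒᵖ] E.carrier, ∃ b : B, ∀ z, b • z = T z) := by
  obtain ⟨F, hf, hg⟩ := hE
  obtain ⟨f, fb, fl, fr, ⟨r, y, x, hyx⟩, hfac⟩ := hf.exists_pairing
  obtain ⟨g, gb, gl, gr, ⟨s, x', y', hxy⟩, -⟩ := hg.exists_pairing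
  -- The two pairings are not assumed to satisfy the associativity law `g(z, m) n = z f(m, n)` of a
  -- Morita context. For fixed `z` the left side is balanced in `(m, n)`, so it factors through `f`.
  -- This gives the corrected law `g(z, m) n = θ(z) f(m, n)` with a right-linear map `θ`, which
  -- suffices once `θ` is known to be surjective.
  have hp : ∀ z : E.carrier, ∃ q : A →ₗ[k] E.carrier, ∀ m n, g z m • n = q (f m n) := by
    intro z
    refine hfac (LinearMap.mk₂ k (fun m n => g z m • n) (fun m m' n => by rw [map_add, add_smul])
      (fun c m n => by rw [map_smul, smul_assoc]) (fun m n n' => by rw [smul_add])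
      (fun c m n => by rw [smul_comm])) fun m b n => ?_
    simp only [LinearMap.mk₂_apply]
    rw [gr, mul_smul]
  choose q hq using hp
  have hq1 : ∀ z a, q z a = op a • q z 1 := by
    intro z a
    have h1 : ∀ m n, q z (f m n * a) = op a • q z (f m n) := fun m n => by
      rw [← fr, ← hq, ← hq, smul_comm]
    calc q z a = q z (∑ j, f (y j) (x j) * a) := by rw [← Finset.sum_mul, hyx, one_mul]
      _ = op a • q z (∑ j, f (y j) (x j)) := by
        simp only [map_sum, Finset.smul_sum, h1]
      _ = op a • q z 1 := by rw [hyx]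
  let θ : E.carrier → E.carrier := fun z => q z 1
  have hgθ : ∀ z m n, g z m • n = op (f m n) • θ z := fun z m n => by rw [hq, hq1]
  have hθ : ∀ z, θ z = ∑ j, g z (y j) • x j := fun z => by
    simp only [hq]
    rw [← map_sum, hyx]
  have hθa : ∀ (a : A) z, θ (op a • z) = op a • θ z := fun a z => by
    rw [hθ]
    calc ∑ j, g (op a • z) (y j) • x j = ∑ j, q z (a * f (y j) (x j)) := by
          refine Finset.sum_congr rfl fun j _ => ?_
          rw [gb, hq, fl]
      _ = op a • θ z := by rw [← map_sum, ← Finset.mul_sum, hyx, mul_one, hq1]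
  have hθsum : ∀ {n : ℕ} (z : Fin n → E.carrier), θ (∑ i, z i) = ∑ i, θ (z i) := fun z => by
    simp only [hθ, map_sum, LinearMap.sum_apply, Finset.sum_smul]
    exact Finset.sum_comm
  -- Let `1 = ∑ g(x'_i, y'_i)` act on `z` and apply the corrected law.
  have hdual : ∀ z, ∑ i, op (f (y' i) z) • θ (x' i) = z := fun z => by
    simp only [← hgθ]
    rw [← Finset.sum_smul, hxy, one_smul]
  have hsurj : ∀ z, ∃ z', θ z' = z := fun z =>
    ⟨∑ i, op (f (y' i) z) • x' i, by simp only [hθsum, hθa, hdual]⟩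
  let φ : F.carrier → E.carrier →ₗ[Aᵐᵒᵖ] A := fun m =>
    { toFun := f m
      map_add' := map_add _
      map_smul' := fun a n => fr a.unop m n }
  refine ⟨⟨s, fun i => θ (x' i), fun i => φ (y' i), hdual⟩, ⟨r, x, fun j => φ (y j), hyx⟩,
    fun b hb => ?_, fun T => ?_⟩
  · rw [← mul_one b, ← hxy, Finset.mul_sum]
    refine Finset.sum_eq_zero fun i _ => ?_
    rw [← gl, hb, map_zero, LinearMap.zero_apply]
  -- An endomorphism is determined on the dual basis vectors `θ(x'_i)`. Preimages `z_i` of their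
  -- images under `θ` make `∑ g(z_i, y'_i)` act as `T`.
  · choose z hz using fun i => hsurj (T (θ (x' i)))
    refine ⟨∑ i, g (z i) (y' i), fun n => ?_⟩
    conv_rhs => rw [← hdual n]
    rw [Finset.sum_smul, map_sum]
    refine Finset.sum_congr rfl fun i _ => ?_
    rw [hgθ, hz, map_smul]

/-- Over an algebra satisfying (I), a dual basis can be modified such that its Gram matrix is a
projection. -/
theorem exists_isStarProjection_dualBasis [StarRing A] (hI : CondI A) (E : AlgBimod k B A) {n : ℕ}
    (x : Fin n → E.carrier) (φ : Fin n → E.carrier →ₗ[Aᵐᵒᵖ] A)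
    (hx : ∀ z, ∑ i, op (φ i z) • x i = z) :
    ∃ (x' : Fin n → E.carrier) (P : Matrix (Fin n) (Fin n) A), IsStarProjection P ∧
      (∀ i j, φ i (x' j) = P i j) ∧ ∀ z, ∑ i, op (φ i z) • x' i = z := by
  let e : Matrix (Fin n) (Fin n) A := Matrix.of fun i j => φ i (x j)
  have he : ∀ i z, φ i z = ∑ j, e i j * φ j z := fun i z => by
    conv_lhs => rw [← hx z]
    simp [e]
  have hee : e * e = e := by
    ext i j
    exact (he i (x j)).symm
  obtain ⟨P, hP, hPe, heP⟩ := exists_isStarProjection_of_isIdempotentElem hee (hI n _)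
  have hPφ : ∀ i z, φ i z = ∑ j, P i j * φ j z := fun i z => by
    have h1 : e.mulVec (fun j => φ j z) = fun j => φ j z := funext fun i => (he i z).symm
    have h2 : P.mulVec (fun j => φ j z) = fun j => φ j z := by
      rw [← h1, Matrix.mulVec_mulVec, hPe]
    exact (congrFun h2 i).symm
  -- Only the vectors change. The functionals satisfy `φ = e φ`, hence `φ = P φ`, and the new Gram
  -- matrix is `e P = P`.
  refine ⟨fun j => ∑ i, op (P i j) • x i, P, hP, fun i j => ?_, fun z => ?_⟩
  · rw [map_sum]
    conv_rhs => rw [← heP, Matrix.mul_apply]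
    simp [e]
  · conv_rhs => rw [← hx z]
    simp only [Finset.smul_sum, smul_smul, ← MulOpposite.op_mul]
    rw [Finset.sum_comm]
    refine Finset.sum_congr rfl fun i _ => ?_
    rw [← Finset.sum_smul]
    conv_rhs => rw [hPφ i z, Finset.op_sum]

end Frames

/-! ### The endomorphism algebra as a corner of a matrix algebra -/

section Corner

variable {R : Type v} [CommRing R] [LinearOrder R] {B A : Type u}
  [Ring B] [StarRing B] [Algebra (Cx R) B] [StarModule (Cx R) B]
  [Ring A] [StarRing A] [Algebra (Cx R) A] [StarModule (Cx R) A]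

/-- A dual basis with Gram matrix `P` identifies `B` with the corner `P M_n(A) P`. -/
theorem exists_ringEquiv_corner (E : AlgBimod (Cx R) B A) {n : ℕ} {x : Fin n → E.carrier}
    {φ : Fin n → E.carrier →ₗ[Aᵐᵒᵖ] A} {P : Matrix (Fin n) (Fin n) A} (hP : IsStarProjection P)
    (hφ : ∀ i j, φ i (x j) = P i j) (hx : ∀ z, ∑ i, op (φ i z) • x i = z)
    (hinj : ∀ b : B, (∀ z : E.carrier, b • z = 0) → b = 0)
    (hsurj : ∀ T : E.carrier →ₗ[Aᵐᵒᵖ] E.carrier, ∃ b : B, ∀ z, b • z = T z) :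
    ∃ e : B ≃+* corner R P hP, (∀ (c : Cx R) (b : B), e (c • b) = c • e b) ∧
      ∀ b i j, (e b : Matrix (Fin n) (Fin n) A) i j = φ i (b • x j) := by
  let m : B → Matrix (Fin n) (Fin n) A := fun b => Matrix.of fun i j => φ i (b • x j)
  have hlin : ∀ (b : B) i z, φ i (b • z) = ∑ j, φ i (b • x j) * φ j z := fun b i z => by
    conv_lhs => rw [← hx z, Finset.smul_sum, map_sum]
    simp only [smul_comm b, map_smul]
    rfl
  have hmul : ∀ b c, m (b * c) = m b * m c := fun b c => by
    ext i j
    simp only [m, Matrix.mul_apply, Matrix.of_apply, mul_smul]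
    exact hlin b i (c • x j)
  have hone : m 1 = P := by
    ext i j
    simp [m, hφ]
  have hmem : ∀ b, m b ∈ corner R P hP := fun b => by
    change P * m b * P = m b
    rw [← hone, ← hmul, ← hmul, one_mul, mul_one]
  have hsmul : ∀ (c : Cx R) b, m (c • b) = c • m b := fun c b => by
    ext i j
    simp only [m, Matrix.of_apply, Matrix.smul_apply, smul_assoc]
    exact LinearMap.map_smul_of_tower (φ i) c (b • x j)
  let f : B →ₙ+* corner R P hP :=
    { toFun := fun b => ⟨m b, hmem b⟩
      map_mul' := fun b c => Subtype.ext (hmul b c)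
      map_zero' := Subtype.ext (by ext i j; simp [m])
      map_add' := fun b c => Subtype.ext (by ext i j; simp [m, add_smul]) }
  have hbij : Function.Bijective f := by
    constructor
    · rw [injective_iff_map_eq_zero]
      intro b hb
      have hb' : m b = 0 := congrArg Subtype.val hb
      refine hinj b fun z => ?_
      rw [← hx (b • z)]
      refine Finset.sum_eq_zero fun i _ => ?_
      rw [hlin]
      have : ∀ j, φ i (b • x j) = 0 := fun j => congrFun (congrFun hb' i) j
      simp [this]
    · rintro ⟨X, hX⟩
      -- The operator with coefficient matrix `X` in the dual basis has matrix `P X P` under `m`,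
      -- which is `X` on the corner.
      let T : E.carrier →ₗ[Aᵐᵒᵖ] E.carrier :=
        { toFun := fun z => ∑ i, op (∑ j, X i j * φ j z) • x i
          map_add' := fun z w => by
            simp only [map_add, mul_add, Finset.sum_add_distrib, MulOpposite.op_add, add_smul]
          map_smul' := fun a z => by
            induction a using MulOpposite.rec' with
            | _ a =>
              simp only [map_smul, op_smul_eq_mul, ← mul_assoc, ← Finset.sum_mul,
                MulOpposite.op_mul, mul_smul, Finset.smul_sum, RingHom.id_apply] }
      obtain ⟨b, hb⟩ := hsurj T
      refine ⟨b, Subtype.ext ?_⟩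
      change m b = X
      have hX' : P * X * P = X := hX
      rw [← hX', mul_assoc]
      ext i j
      simp only [m, Matrix.of_apply, hb]
      change φ i (∑ k, op (∑ l, X k l * φ l (x j)) • x k) = _
      simp only [map_sum, map_smul, op_smul_eq_mul, hφ, Matrix.mul_apply]
  exact ⟨RingEquiv.ofBijective f hbij, fun c b => Subtype.ext (hsmul c b), fun _ _ _ => rfl⟩

end Corner

end AlgBimod

/-! ### Strong equivalence bimodules are strongly invertible -/

namespace FormBimod

section

variable {k : Type v} {D B A : Type u} [CommRing k] [StarRing k]
  [Ring D] [StarRing D] [Algebra k D] [StarModule k D]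
  [Ring B] [StarRing B] [Algebra k B] [StarModule k B]
  [Ring A] [StarRing A] [Algebra k A] [StarModule k A]

theorem nondegenerate_self : (self k A).Nondegenerate := fun (a : A) h => by
  have : star a * 1 = 0 := h (1 : A)
  rwa [mul_one, star_eq_zero] at this

/-- A surjective isometric bimodule map from the algebraic tensor product to a bimodule with
non-degenerate inner product induces an isomorphism from the internal tensor product. -/
theorem iso_internalTensor (M : FormBimod k D B) (N : FormBimod k B A) (X : FormBimod k D A)
    (hX : X.Nondegenerate) (f : M.carrier ⊗[k] N.carrier →ₗ[k] X.carrier)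
    (f1 : ∀ (d : D) m n, f ((d • m) ⊗ₜ n) = d • f (m ⊗ₜ n))
    (f2 : ∀ (a : A) m n, f (m ⊗ₜ (op a • n)) = op a • f (m ⊗ₜ n))
    (f3 : Function.Surjective f)
    (f4 : ∀ m n m' n', X.ip (f (m ⊗ₜ n)) (f (m' ⊗ₜ n')) = N.ip n (M.ip m m' • n')) :
    Iso (M.internalTensor N) X := by
  have f4' : ∀ s t, X.ip (f s) (f t) = tensorForm M N s t := by
    intro s t
    induction s with
    | zero => simp [ip_zero_left]
    | add s s' h h' => rw [map_add, ip_add_left, h, h', map_add, LinearMap.add_apply]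
    | tmul m n =>
      induction t with
      | zero => simp [ip_zero]
      | add t t' h h' => rw [map_add, X.ip_add, h, h', map_add]
      | tmul m' n' => exact f4 m n m' n'
  -- Surjectivity of `f` and non-degeneracy of `X` identify the kernel of `f` with the degeneracy
  -- space, which already contains the balancing relations.
  have hker : ∀ s, f s = 0 ↔ ∀ t, tensorForm M N s t = 0 := by
    intro s
    refine ⟨fun h t => by rw [← f4', h, ip_zero_left], fun h => hX _ fun y => ?_⟩
    obtain ⟨t, rfl⟩ := f3 y
    rw [f4', h]
  let K := AlgBimod.balance M.toAlgBimod N.toAlgBimod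
  have hK : K ≤ LinearMap.ker f := fun s hs => (hker s).2 (balance_degenerate M N hs)
  let f' : (M.tensor N).carrier →ₗ[k] X.carrier := K.liftQ f hK
  let q : M.carrier ⊗[k] N.carrier →ₗ[k] (M.tensor N).carrier := K.mkQ
  have hq : Function.Surjective q := K.mkQ_surjective
  have hf'q : ∀ s, f' (q s) = f s := fun _ => rfl
  have hker' : (M.tensor N).degeneracy = LinearMap.ker f' := by
    ext y
    obtain ⟨s, rfl⟩ := hq y
    rw [LinearMap.mem_ker, hf'q, hker]
    refine ⟨fun h t => h (q t), fun h y => ?_⟩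
    obtain ⟨t, rfl⟩ := hq y
    exact h t
  have f3' : Function.Surjective f' := fun y => by
    obtain ⟨s, rfl⟩ := f3 y
    exact ⟨q s, rfl⟩
  let g : (M.internalTensor N).carrier ≃ₗ[k] X.carrier :=
    (Submodule.quotEquivOfEq _ _ hker').trans (f'.quotKerEquivOfSurjective f3')
  let q₂ : (M.tensor N).carrier →ₗ[k] (M.internalTensor N).carrier :=
    (M.tensor N).degeneracy.mkQ
  have hq₂ : Function.Surjective q₂ := Submodule.mkQ_surjective _
  have hg : ∀ s, g (q₂ (q s)) = f s := fun _ => rfl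
  have hsurj : ∀ y, ∃ s, q₂ (q s) = y := fun y => by
    obtain ⟨z, rfl⟩ := hq₂ y
    obtain ⟨s, rfl⟩ := hq z
    exact ⟨s, rfl⟩
  refine ⟨g, fun d y => ?_, fun a y => ?_, fun y z => ?_⟩
  · obtain ⟨s, rfl⟩ := hsurj y
    change f (d • s) = d • f s
    induction s with
    | zero => simp
    | add s s' h h' => simp only [smul_add, map_add, h, h']
    | tmul m n => rw [TensorProduct.smul_tmul', f1]
  · obtain ⟨s, rfl⟩ := hsurj y
    change f ((N.rmul (op a)).lTensor M.carrier s) = op a • f s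
    induction s with
    | zero => simp
    | add s s' h h' => simp only [smul_add, map_add, h, h']
    | tmul m n => exact f2 a m n
  · obtain ⟨s, rfl⟩ := hsurj y
    obtain ⟨t, rfl⟩ := hsurj z
    rw [hg, hg, f4']
    rfl

end

end FormBimod

namespace StrongEquivBimod

section

variable {R : Type v} [CommRing R] [LinearOrder R] {B A : Type u}
  [Ring B] [StarRing B] [Algebra (Cx R) B] [StarModule (Cx R) B]
  [Ring A] [StarRing A] [Algebra (Cx R) A] [StarModule (Cx R) A]

variable (S : StrongEquivBimod R B A)

theorem ipL_add_right (x y z : S.carrier) : S.ipL x (y + z) = S.ipL x y + S.ipL x z := by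
  rw [← S.ipL_star, S.ipL_add, star_add, S.ipL_star, S.ipL_star]

theorem ipL_smul_right (c : Cx R) (x y : S.carrier) : S.ipL x (c • y) = star c • S.ipL x y := by
  rw [← S.ipL_star, S.ipL_smul, star_smul, S.ipL_star]

theorem ipL_mul_right (b : B) (x y : S.carrier) : S.ipL x (b • y) = S.ipL x y * star b := by
  rw [← S.ipL_star, S.ipL_mul, star_mul, S.ipL_star]

/-- The additive group underlying the complex conjugate bimodule. -/
def ConjCarrier : Type u := S.carrier

instance : AddCommGroup S.ConjCarrier := inferInstanceAs (AddCommGroup S.carrier)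

/-- An element of `S` as an element of the complex conjugate bimodule. -/
def toConj : S.carrier ≃+ S.ConjCarrier := AddEquiv.refl _

instance : Module (Cx R) S.ConjCarrier where
  smul c x := S.toConj (star c • S.toConj.symm x)
  one_smul x := by
    change star (1 : Cx R) • S.toConj.symm x = _
    rw [star_one, one_smul]; rfl
  mul_smul c d x := by
    change star (c * d) • S.toConj.symm x = star c • star d • S.toConj.symm x
    rw [star_mul', mul_smul]
  smul_zero c := smul_zero (A := S.carrier) (star c)
  smul_add c := smul_add (A := S.carrier) (star c)
  add_smul c d x := by
    change star (c + d) • S.toConj.symm x = star c • S.toConj.symm x + star d • S.toConj.symm x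
    rw [star_add, add_smul]
  zero_smul x := by
    change star (0 : Cx R) • S.toConj.symm x = (0 : S.carrier)
    rw [star_zero, zero_smul]

instance : Module A S.ConjCarrier where
  smul a x := S.toConj (op (star a) • S.toConj.symm x)
  one_smul x := by
    change op (star (1 : A)) • S.toConj.symm x = _
    rw [star_one, MulOpposite.op_one, one_smul]; rfl
  mul_smul a b x := by
    change op (star (a * b)) • S.toConj.symm x = op (star a) • op (star b) • S.toConj.symm x
    rw [star_mul, MulOpposite.op_mul, mul_smul]
  smul_zero a := smul_zero (A := S.carrier) (op (star a))
  smul_add a := smul_add (A := S.carrier) (op (star a))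
  add_smul a b x := by
    change op (star (a + b)) • S.toConj.symm x =
      op (star a) • S.toConj.symm x + op (star b) • S.toConj.symm x
    rw [star_add, MulOpposite.op_add, add_smul]
  zero_smul x := by
    change op (star (0 : A)) • S.toConj.symm x = (0 : S.carrier)
    rw [star_zero, MulOpposite.op_zero, zero_smul]

instance : Module Bᵐᵒᵖ S.ConjCarrier where
  smul b x := S.toConj (star b.unop • S.toConj.symm x)
  one_smul x := by
    change star (1 : B) • S.toConj.symm x = _
    rw [star_one, one_smul]; rfl
  mul_smul c d x := by
    change star (d.unop * c.unop) • S.toConj.symm x =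
      star c.unop • star d.unop • S.toConj.symm x
    rw [star_mul, mul_smul]
  smul_zero c := smul_zero (A := S.carrier) (star c.unop)
  smul_add c := smul_add (A := S.carrier) (star c.unop)
  add_smul c d x := by
    change star (c.unop + d.unop) • S.toConj.symm x =
      star c.unop • S.toConj.symm x + star d.unop • S.toConj.symm x
    rw [star_add, add_smul]
  zero_smul x := by
    change star (0 : B) • S.toConj.symm x = (0 : S.carrier)
    rw [star_zero, zero_smul]

/-- The complex conjugate of a strong equivalence bimodule with its inner product. -/
def conj : FormBimod (Cx R) A B where
  carrier := S.ConjCarrier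
  comm := ⟨fun a b x => (smul_comm (star b.unop) (op (star a)) (S.toConj.symm x)).symm⟩
  towerLeft := ⟨fun c a x => by
    change op (star (c • a)) • S.toConj.symm x = star c • op (star a) • S.toConj.symm x
    rw [star_smul, MulOpposite.op_smul, smul_assoc]⟩
  towerRight := ⟨fun c b x => by
    change star (c • b.unop) • S.toConj.symm x = star c • star b.unop • S.toConj.symm x
    rw [star_smul, smul_assoc]⟩
  ip x y := S.ipL (S.toConj.symm x) (S.toConj.symm y)
  ip_add x := S.ipL_add_right (S.toConj.symm x)
  ip_smul c x y := by
    change S.ipL (S.toConj.symm x) (star c • S.toConj.symm y) = _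
    rw [ipL_smul_right, star_star]
  ip_star x y := S.ipL_star _ _
  ip_mul x y b := by
    change S.ipL (S.toConj.symm x) (star b • S.toConj.symm y) = _
    rw [ipL_mul_right, star_star]
  ip_compat a x y := by
    change S.ipL (op (star a) • S.toConj.symm x) (S.toConj.symm y) =
      S.ipL (S.toConj.symm x) (op (star (star a)) • S.toConj.symm y)
    rw [S.ipL_compat]

/-- The isomorphism is induced by the inner product itself: fullness makes it surjective, and `x⟨y,
z⟩ = ⟨x, y⟩z` makes it isometric. -/
theorem iso_conj_tensor :
    FormBimod.Iso (S.conj.internalTensor S.toFormBimod) (FormBimod.self (Cx R) A) := by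
  let f : S.conj.carrier ⊗[Cx R] S.carrier →ₗ[Cx R] A :=
    TensorProduct.lift (LinearMap.mk₂ (Cx R) (fun (x : S.carrier) y => S.ip x y)
      (fun (x y : S.carrier) z => FormBimod.ip_add_left S.toFormBimod x y z)
      (fun c (x : S.carrier) y => by
        change S.ip (star c • x) y = _
        rw [FormBimod.ip_smul_left S.toFormBimod, star_star])
      S.ip_add (fun c x y => S.ip_smul c x y) :
      S.conj.carrier →ₗ[Cx R] S.carrier →ₗ[Cx R] A)
  have hf : ∀ (x y : S.carrier), f (S.toConj x ⊗ₜ y) = S.ip x y := fun _ _ => rfl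
  have hsurj : Function.Surjective f := by
    rw [← LinearMap.range_eq_top, ← top_le_iff]
    refine S.ip_full.ge.trans (Submodule.span_le.2 ?_)
    rintro _ ⟨x, y, rfl⟩
    exact ⟨S.toConj x ⊗ₜ y, rfl⟩
  refine FormBimod.iso_internalTensor _ _ _ FormBimod.nondegenerate_self f ?_ ?_ ?_ ?_
  · intro a (x : S.carrier) y
    change S.ip (op (star a) • x) y = a * S.ip x y
    rw [FormBimod.ip_mul_left, star_star]
  · exact fun a x y => S.ip_mul x y a
  · exact hsurj
  · intro (x : S.carrier) y (x' : S.carrier) y'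
    change star (S.ip x y) * S.ip x' y' = S.ip y (S.ipL x x' • y')
    rw [← S.ip_ipL, S.ip_mul, S.ip_star]

theorem iso_tensor_conj :
    FormBimod.Iso (S.toFormBimod.internalTensor S.conj) (FormBimod.self (Cx R) B) := by
  let f : S.carrier ⊗[Cx R] S.conj.carrier →ₗ[Cx R] B :=
    TensorProduct.lift (LinearMap.mk₂ (Cx R) (fun x (y : S.carrier) => S.ipL x y)
      S.ipL_add S.ipL_smul S.ipL_add_right
      (fun c x (y : S.carrier) => by
        change S.ipL x (star c • y) = _
        rw [ipL_smul_right, star_star]) :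
      S.carrier →ₗ[Cx R] S.conj.carrier →ₗ[Cx R] B)
  have hsurj : Function.Surjective f := by
    rw [← LinearMap.range_eq_top, ← top_le_iff]
    refine S.ipL_full.ge.trans (Submodule.span_le.2 ?_)
    rintro _ ⟨x, y, rfl⟩
    exact ⟨x ⊗ₜ S.toConj y, rfl⟩
  refine FormBimod.iso_internalTensor _ _ _ FormBimod.nondegenerate_self f ?_ ?_ ?_ ?_
  · exact fun b x y => S.ipL_mul b x y
  · intro b x (y : S.carrier)
    change S.ipL x (star b • y) = S.ipL x y * b
    rw [ipL_mul_right, star_star]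
  · exact hsurj
  · intro x (y : S.carrier) x' (y' : S.carrier)
    change star (S.ipL x y) * S.ipL x' y' = S.ipL y (op (star (S.ip x x')) • y')
    rw [S.ipL_star, ← S.ipL_mul, ← S.ip_ipL, S.ipL_compat]

theorem invertible : S.toFormBimod.Invertible :=
  ⟨⟨S.ip_nondegenerate, S.ip_completelyPositive⟩, S.conj,
    ⟨S.ipL_nondegenerate, S.ipL_completelyPositive⟩, S.iso_conj_tensor, S.iso_tensor_conj⟩

end

end StrongEquivBimod

/-- Forgetting inner products is harmless because, for strongly invertible bimodules, the balanced
tensor product is already the unit bimodule before dividing by the degeneracy space. None of (I),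
(II), (III) enters. -/
theorem StrongMoritaEquivalent.ringMoritaEquivalent {R : Type v} [CommRing R] [LinearOrder R]
    {B A : Type u} [Ring B] [StarRing B] [Algebra (Cx R) B] [StarModule (Cx R) B]
    [Ring A] [StarRing A] [Algebra (Cx R) A] [StarModule (Cx R) A]
    (h : StrongMoritaEquivalent R B A) : RingMoritaEquivalent (Cx R) B A := by
  obtain ⟨S⟩ := h
  exact ⟨S.toAlgBimod, S.invertible.toAlgBimod⟩

/-! ### Strong equivalence bimodules from invertible bimodules -/

section

variable {R : Type v} [CommRing R] [LinearOrder R] [IsStrictOrderedRing R] {B A : Type u}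
  [Ring B] [StarRing B] [Algebra (Cx R) B] [StarModule (Cx R) B]
  [Ring A] [StarRing A] [Algebra (Cx R) A] [StarModule (Cx R) A]

theorem FormBimod.ip_sum (E : FormBimod (Cx R) B A) {κ : Type*} (s : Finset κ) (x : E.carrier)
    (y : κ → E.carrier) : E.ip x (∑ i ∈ s, y i) = ∑ i ∈ s, E.ip x (y i) :=
  map_sum (AddMonoidHom.mk' (E.ip x) (E.ip_add x)) y s

theorem FormBimod.ip_sum_left (E : FormBimod (Cx R) B A) {κ : Type*} (s : Finset κ)
    (x : κ → E.carrier) (y : E.carrier) : E.ip (∑ i ∈ s, x i) y = ∑ i ∈ s, E.ip (x i) y :=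
  map_sum (AddMonoidHom.mk' (fun x => E.ip x y) (fun a b => E.ip_add_left a b y)) x s

/-- A bimodule with inner product which has a Parseval frame, represents the unit as a sum of
squares, and on which `B` acts faithfully and by all operators of rank one, is a strong equivalence
bimodule. -/
theorem FormBimod.exists_strongEquivBimod (E : FormBimod (Cx R) B A)
    {κ : Type*} [Fintype κ] (x : κ → E.carrier) (hx : ∀ z, ∑ i, op (E.ip (x i) z) • x i = z)
    {μ : Type*} [Fintype μ] (w : μ → E.carrier) (hw : ∑ j, E.ip (w j) (w j) = 1)
    (hinj : ∀ b : B, (∀ z : E.carrier, b • z = 0) → b = 0)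
    (hsurj : ∀ y z : E.carrier, ∃ b : B, ∀ t : E.carrier, b • t = op (E.ip z t) • y) :
    ∃ S : StrongEquivBimod R B A, S.toFormBimod = E := by
  choose θ hθ using hsurj
  have hext : ∀ b c : B, (∀ z : E.carrier, b • z = c • z) → b = c := fun b c h =>
    sub_eq_zero.1 (hinj _ fun z => by rw [sub_smul, h, sub_self])
  have hnd : E.Nondegenerate := by
    intro y hy
    rw [← hx y]
    refine Finset.sum_eq_zero fun i _ => ?_
    rw [← E.ip_star, hy, star_zero, MulOpposite.op_zero, zero_smul]
  have hmul : ∀ (b : B) y z, θ (b • y) z = b * θ y z := fun b y z => hext _ _ fun t => by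
    rw [hθ, mul_smul, hθ, ← smul_comm b]
  have hcompat : ∀ (a : A) y z, θ (op a • y) z = θ y (op (star a) • z) := fun a y z =>
    hext _ _ fun t => by
      rw [hθ, hθ, E.ip_mul_left, star_star, MulOpposite.op_mul, mul_smul]
  have hstar : ∀ y z, star (θ y z) = θ z y := fun y z => hext _ _ fun t => hnd.ext fun s => by
    rw [E.ip_compat', star_star, hθ, hθ, E.ip_mul_left, E.ip_mul, E.ip_star]
  have hadd : ∀ x y z, θ (x + y) z = θ x z + θ y z := fun x y z => hext _ _ fun t => by
    rw [add_smul, hθ, hθ, hθ, smul_add]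
  have hsmul : ∀ (c : Cx R) x y, θ (c • x) y = c • θ x y := fun c x y => hext _ _ fun t => by
    rw [smul_assoc, hθ, hθ, smul_comm]
  have hθθ : ∀ y z s t, θ y z * θ s t = θ (op (E.ip z s) • y) t := fun y z s t => by
    rw [← hmul, hθ]
  -- Inserting `1 = ∑ ⟨w_j, w_j⟩` into `y` gives `θ(y, z) = ∑ θ(y, w_j) θ(w_j, z)`, a sum of
  -- squares.
  have hθw : ∀ y z, θ y z = ∑ j, star (θ (w j) y) * θ (w j) z := fun y z => by
    have hsum : ∀ v : μ → E.carrier, θ (∑ j, v j) z = ∑ j, θ (v j) z := fun v =>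
      map_sum (AddMonoidHom.mk' (fun x => θ x z) (fun a b => hadd a b z)) v _
    simp only [hstar, hθθ]
    rw [← hsum, ← Finset.sum_smul, ← Finset.op_sum, hw, MulOpposite.op_one, one_smul]
  have hcp : ∀ y z, E.ip y z = ∑ i, star (E.ip (x i) y) * E.ip (x i) z := fun y z => by
    conv_lhs => rw [← hx z, E.ip_sum]
    refine Finset.sum_congr rfl fun i _ => ?_
    rw [E.ip_mul, E.ip_star]
  -- The Parseval identity read in `B`; it yields fullness of the `B`-valued product.
  have hone : ∑ i, θ (x i) (x i) = 1 := hext _ _ fun t => by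
    simp only [Finset.sum_smul, hθ, hx, one_smul]
  refine ⟨{ toFormBimod := E
            ip_nondegenerate := hnd
            ip_full := ?_
            ipL := θ
            ipL_add := hadd
            ipL_smul := hsmul
            ipL_star := hstar
            ipL_mul := hmul
            ipL_compat := hcompat
            ipL_nondegenerate := fun y hy => ?_
            ipL_full := ?_
            ip_ipL := fun y z t => (hθ y z t).symm
            ip_completelyPositive := isCompletelyPositive_of_eq_sum _ (fun i y => E.ip (x i) y) hcp
            ipL_completelyPositive :=
              isCompletelyPositive_of_eq_sum _ (fun j y => θ (w j) y) hθw }, rfl⟩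
  · refine eq_top_iff.2 fun a _ => ?_
    rw [← one_mul a, ← hw, Finset.sum_mul]
    exact sum_mem fun j _ => Submodule.subset_span ⟨w j, op a • w j, (E.ip_mul _ _ _).symm⟩
  · rw [← one_smul Aᵐᵒᵖ y, ← MulOpposite.op_one, ← hw, Finset.op_sum, Finset.sum_smul]
    refine Finset.sum_eq_zero fun j _ => ?_
    rw [← hθ, hy, zero_smul]
  · refine eq_top_iff.2 fun b _ => ?_
    rw [← mul_one b, ← hone, Finset.mul_sum]
    exact sum_mem fun j _ => Submodule.subset_span ⟨b • x j, x j, (hmul _ _ _).symm⟩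

/-- Polarization: `∑ ⟨y_j + z_j, y_j + z_j⟩` equals `1 + 1` plus the sums of `⟨y_j, y_j⟩` and `⟨z_j,
z_j⟩`, which the frame turns into sums of squares in `A`. Condition (I) makes the total invertible,
and (II⁻) normalizes it. -/
theorem FormBimod.exists_sum_ip_self_eq_one (hI : CondI A) (hII : CondIIMinus R A)
    (E : FormBimod (Cx R) B A) {κ : Type*} [Fintype κ] (x : κ → E.carrier)
    (hx : ∀ z, ∑ i, op (E.ip (x i) z) • x i = z) {μ : Type*} [Fintype μ] (y z : μ → E.carrier)
    (hyz : ∑ j, E.ip (y j) (z j) = 1) : ∃ w : μ → E.carrier, ∑ j, E.ip (w j) (w j) = 1 := by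
  have hcp : ∀ t : μ → E.carrier, ∑ j, E.ip (t j) (t j) =
      ∑ p : μ × κ, star (E.ip (x p.2) (t p.1)) * E.ip (x p.2) (t p.1) := fun t => by
    rw [Fintype.sum_prod_type]
    refine Finset.sum_congr rfl fun j _ => ?_
    conv_lhs => rw [← hx (t j), E.ip_sum]
    refine Finset.sum_congr rfl fun i _ => ?_
    rw [E.ip_mul, hx, E.ip_star]
  have hzy : ∑ j, E.ip (z j) (y j) = 1 := by
    simpa [E.ip_star] using congrArg star hyz
  have hu : IsUnit (∑ j, E.ip (y j + z j) (y j + z j)) := by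
    -- The index `none` contributes the second `1`, coming from `∑ ⟨z_j, y_j⟩`.
    have h := hI.isUnit_one_add_sum (fun p : Option ((μ × κ) ⊕ (μ × κ)) => match p with
      | none => 1
      | some (Sum.inl p) => E.ip (x p.2) (y p.1)
      | some (Sum.inr p) => E.ip (x p.2) (z p.1))
    rw [Fintype.sum_option, Fintype.sum_sum_type] at h
    simp only [star_one, one_mul, ← hcp] at h
    convert h using 1
    simp only [E.ip_add, E.ip_add_left, Finset.sum_add_distrib, hyz, hzy]
    abel
  rw [hcp] at hu
  obtain ⟨c, hc⟩ := hII.exists_normalize _ hu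
  refine ⟨fun j => op c • (y j + z j), ?_⟩
  rw [← hcp fun j => y j + z j] at hc
  rw [← hc, Finset.mul_sum, Finset.sum_mul]
  exact Finset.sum_congr rfl fun j _ => by rw [E.ip_mul, E.ip_mul_left]

/-- Up to an automorphism of `B`, an invertible bimodule underlies a strong equivalence bimodule. -/
theorem AlgBimod.Invertible.exists_strongEquivBimod (hIII : CondIII R A B) (hI : CondI A)
    (hII : CondIIMinus R A) {E : AlgBimod (Cx R) B A} (hE : E.Invertible) :
    ∃ (Φ : B ≃ₐ[Cx R] B) (S : StrongEquivBimod R B A), S.toAlgBimod = E.twist Φ := by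
  obtain ⟨⟨n, x₀, φ, hx₀⟩, ⟨m, u, ψ, hψ⟩, hinj, hsurj⟩ := hE.exists_dualBasis
  obtain ⟨x, P, hP, hφ, hx⟩ := E.exists_isStarProjection_dualBasis hI x₀ φ hx₀
  obtain ⟨e, he, heφ⟩ := E.exists_ringEquiv_corner hP hφ hx hinj hsurj
  obtain ⟨σ⟩ := hIII n P hP ⟨e, he⟩
  -- By this choice, `b` acts on the twisted bimodule through the matrix `σ b`, and `σ` respects the
  -- involution although `e` need not.
  let Φ₀ : B ≃+* B := σ.toRingEquiv.trans e.symm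
  have heΦ₀ : ∀ b, e (Φ₀ b) = σ b := fun b => e.apply_symm_apply (σ b)
  let Φ : B ≃ₐ[Cx R] B := AlgEquiv.ofRingEquiv (f := Φ₀) fun c => by
    rw [Algebra.algebraMap_eq_smul_one]
    apply e.injective
    rw [heΦ₀, he, map_smul, ← heΦ₀, map_one]
  have hσ : ∀ b i j, φ i (Φ b • x j) = (σ b : Matrix (Fin n) (Fin n) A) i j := fun b i j => by
    rw [← heφ]
    exact congrArg (fun X : corner R P hP => (X : Matrix (Fin n) (Fin n) A) i j) (heΦ₀ b)
  have hlin : ∀ b i z, φ i (Φ b • z) =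
      ∑ j, (σ b : Matrix (Fin n) (Fin n) A) i j * φ j z := fun b i z => by
    conv_lhs => rw [← hx z, Finset.smul_sum, map_sum]
    refine Finset.sum_congr rfl fun j _ => ?_
    rw [smul_comm, map_smul, hσ, op_smul_eq_mul]
  let F : FormBimod (Cx R) B A :=
    { toAlgBimod := E.twist Φ
      ip := fun z w : E.carrier => ∑ i, star (φ i z) * φ i w
      ip_add := fun (z w t : E.carrier) => by
        change ∑ i, star (φ i z) * φ i (w + t) = _
        simp only [map_add, mul_add, Finset.sum_add_distrib]
      ip_smul := fun c (z w : E.carrier) => by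
        have : ∀ i, φ i (c • w) = c • φ i w := fun i => LinearMap.map_smul_of_tower (φ i) c w
        change ∑ i, star (φ i z) * φ i (c • w) = _
        simp only [this, mul_smul_comm, Finset.smul_sum]
      ip_star := fun (z w : E.carrier) => by
        simp only [star_sum, star_mul, star_star]
      ip_mul := fun (z w : E.carrier) a => by
        change ∑ i, star (φ i z) * φ i (op a • w) = _
        simp only [map_smul, op_smul_eq_mul, Finset.sum_mul, mul_assoc]
      ip_compat := fun b (z w : E.carrier) => by
        change ∑ i, star (φ i (Φ b • z)) * φ i w = ∑ i, star (φ i z) * φ i (Φ (star b) • w)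
        have hs : ∀ i j, (σ (star b) : Matrix (Fin n) (Fin n) A) i j =
            star ((σ b : Matrix (Fin n) (Fin n) A) j i) := fun i j => by
          rw [map_star]; rfl
        simp only [hlin, hs, star_sum, star_mul, Finset.sum_mul, Finset.mul_sum, mul_assoc]
        exact Finset.sum_comm }
  let xF : Fin n → F.carrier := x
  let φF : Fin n → F.carrier →ₗ[Aᵐᵒᵖ] A := φ
  let ψF : Fin m → F.carrier →ₗ[Aᵐᵒᵖ] A := ψ
  have hxF : ∀ z, ∑ i, op (φF i z) • xF i = z := hx
  -- Self-adjointness of `P` makes the dual basis a Parseval frame for the new inner product.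
  have hipF : ∀ i z, F.ip (xF i) z = φF i z := fun i z => by
    change ∑ k, star (φ k (x i)) * φ k z = φF i z
    conv_rhs => rw [← hxF z, map_sum]
    refine Finset.sum_congr rfl fun k _ => ?_
    rw [hφ, map_smul, op_smul_eq_mul]
    congr 1
    exact (congrFun (congrFun hP.isSelfAdjoint i) k).trans (hφ i k).symm
  have hframe : ∀ z, ∑ i, op (F.ip (xF i) z) • xF i = z := fun z => by
    simp only [hipF, hxF]
  -- Every functional is represented by a vector, so the generator property takes the form `∑ ⟨y_j,
  -- u_j⟩ = 1`.
  have hipψ : ∀ j z, F.ip (∑ i, op (star (ψF j (xF i))) • xF i) z = ψF j z := fun j z => by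
    rw [F.ip_sum_left]
    conv_rhs => rw [← hxF z, map_sum]
    refine Finset.sum_congr rfl fun i _ => ?_
    rw [F.ip_mul_left, star_star, hipF, map_smul, op_smul_eq_mul]
  obtain ⟨w, hw⟩ := F.exists_sum_ip_self_eq_one hI hII xF hframe
    (fun j => ∑ i, op (star (ψF j (xF i))) • xF i) u
    ((Finset.sum_congr rfl fun j _ => hipψ j (u j)).trans hψ)
  obtain ⟨S, hS⟩ := F.exists_strongEquivBimod xF hframe w hw
    (fun b hb => (map_eq_zero_iff Φ Φ.injective).1 (hinj _ hb))
    (fun y z => by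
      let T : F.carrier →ₗ[Aᵐᵒᵖ] F.carrier :=
        { toFun := fun t => op (F.ip z t) • y
          map_add' := fun t s => by rw [F.ip_add, MulOpposite.op_add, add_smul]
          map_smul' := fun a t => by
            rw [← MulOpposite.op_unop a, F.ip_mul, MulOpposite.op_mul, mul_smul, RingHom.id_apply] }
      obtain ⟨b, hb⟩ := hsurj T
      exact ⟨Φ.symm b, fun t =>
        (congrArg (fun c : B => c • (show E.carrier from t)) (Φ.apply_symm_apply b)).trans (hb t)⟩)
  exact ⟨Φ, S, congrArg FormBimod.toAlgBimod hS⟩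

/-! ### Surjectivity modulo automorphisms and comparison of the two Morita relations -/

theorem strPicToPicModAut_surjective (hIII : CondIII R A B) (hI : CondI A)
    (hII : CondIIMinus R A) : Function.Surjective (strPicToPicModAut R B A) := by
  intro q
  induction q using Quotient.inductionOn with
  | _ p =>
    induction p using Quotient.inductionOn with
    | _ E =>
      obtain ⟨E, hE⟩ := E
      obtain ⟨Φ, S, hS⟩ := hE.exists_strongEquivBimod hIII hI hII
      refine ⟨Quotient.mk _ ⟨S.toFormBimod, S.invertible⟩, Quotient.sound ?_⟩
      refine ⟨op Φ, Quotient.sound ?_⟩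
      change AlgBimod.Iso (E.twist Φ) S.toAlgBimod
      rw [hS]
      exact AlgBimod.Iso.refl _

theorem ringMoritaEquivalent_iff_strongMoritaEquivalent (hIII : CondIII R A B) (hI : CondI A)
    (hII : CondIIMinus R A) : RingMoritaEquivalent (Cx R) B A ↔ StrongMoritaEquivalent R B A := by
  refine ⟨?_, StrongMoritaEquivalent.ringMoritaEquivalent⟩
  rintro ⟨E, hE⟩
  obtain ⟨-, S, -⟩ := hE.exists_strongEquivBimod hIII hI hII
  exact ⟨S⟩

end

theorem corollary7p8 {R : Type v} [CommRing R] [LinearOrder R] [IsStrictOrderedRing R] :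
    (∀ (A B : Type u) [Ring A] [StarRing A] [Algebra (Cx R) A] [StarModule (Cx R) A]
        [Ring B] [StarRing B] [Algebra (Cx R) B] [StarModule (Cx R) B],
      CondIII R A B → CondI A → CondIIMinus R A →
        Function.Surjective (strPicToPicModAut R B A)) ∧
    (∀ K : Set (UnitalStarAlg.{u} R),
      (∀ A ∈ K, CondI A.carrier) →
      (∀ A ∈ K, CondII R A.carrier) →
      (∀ A ∈ K, ∀ B ∈ K, CondIII R A.carrier B.carrier) →
        (∀ A ∈ K, ∀ B ∈ K, RingMoritaEquivalent (Cx R) B.carrier A.carrier ↔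
          StrongMoritaEquivalent R B.carrier A.carrier) ∧
        Equivalence (fun B A : K => RingMoritaEquivalent (Cx R) B.1.carrier A.1.carrier) ∧
        Equivalence (fun B A : K => StrongMoritaEquivalent R B.1.carrier A.1.carrier)) := by
  refine ⟨fun A B => strPicToPicModAut_surjective, fun K hI hII hIII => ?_⟩
  have hiff : ∀ A ∈ K, ∀ B ∈ K, RingMoritaEquivalent (Cx R) B.carrier A.carrier ↔
      StrongMoritaEquivalent R B.carrier A.carrier := fun A hA B hB =>
    ringMoritaEquivalent_iff_strongMoritaEquivalent (hIII A hA B hB) (hI A hA)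
      (hII A hA).condIIMinus
  have hring : Equivalence
      (fun B A : K => RingMoritaEquivalent (Cx R) B.1.carrier A.1.carrier) :=
    ⟨fun A => .refl A.1.carrier, .symm, .trans⟩
  refine ⟨hiff, hring, ?_⟩
  -- Strong Morita equivalence inherits the equivalence properties from the ring-theoretic relation,
  -- with which it coincides on `K`.
  convert hring using 3 with B A
  exact (hiff A.1 A.2 B.1 B.2).symm
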